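/- Let $\mathcal X$ be a compact metric space, let $\mathcal M^+(\mathcal X)$ be the set of finite positive Borel measures on $\mathcal X$ with the weak* topology (convergence against continuous functions), and let $\langle\alpha,f\rangle=\int f\,d\alpha$. Let $\varepsilon>0$ and let $\phi:[0,\infty)\to[0,\infty]$ be an entropy function, i.e. convex, lower semicontinuous, with $\phi(1)=0$; let $\phi^*(q)=\sup_{p\ge 0}\,(pq-\phi(p))$, with $\phi^*(+\infty)=+\infty$. Let $C:\mathcal X^2\to\mathbb R$ be continuous and symmetric. Assume that the kernel $k_\varepsilon=e^{-C/\varepsilon}$ is positive ($\iint k_\varepsilon\,d\sigma\,d\sigma\ge 0$ for every finite signed measure $\sigma$) and universal (the linear span of the functions $k_\varepsilon(\cdot,y)$, $y\in\mathcal X$, is dense in $\mathcal C(\mathcal X)$). For $\alpha\in\mathcal M^+(\mathcal X)$ the Sinkhorn entropy is $$F_\varepsilon(\alpha)=-\sup_{f\in\mathcal C(\mathcal X)}\Big(\langle\alpha,-\phi^*(-f)\rangle-\tfrac{\varepsilon}{2}\big\langle\alpha\otimes\alpha,e^{(f\oplus f-C)/\varepsilon}\big\rangle\Big),$$ where $(f\oplus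 f)(x,y)=f(x)+f(y)$, and a function $f\in\mathcal C(\mathcal X)$ attaining the supremum is called an optimal dual potential for $F_\varepsilon(\alpha)$. Then: 1. For every $\alpha\in\mathcal M^+(\mathcal X)$, $F_\varepsilon(\alpha)$ is finite and $$F_\varepsilon(\alpha)=\inf_{\mu\in\mathcal M^+(\mathcal X)}\ \Big\langle\alpha,\phi^*\big(-\varepsilon\log\tfrac{d\mu}{d\alpha}\big)\Big\rangle+\tfrac{\varepsilon}{2}\iint k_\varepsilon(x,y)\,d\mu(x)\,d\mu(y),$$ where $\frac{d\mu}{d\alpha}$ is the density of the absolutely continuous part of $\mu$ with respect to $\alpha$ and $\log 0=-\infty$. The infimum is attained at exactly one measure $\mu_\alpha\in\mathcal M^+(\mathcal X)$. 2. $\mu_\alpha$ and $\alpha$ are mutually absolutely continuous, and $\varepsilon\log\frac{d\mu_\alpha}{d\alpha}$ is the optimal dual potential for $F_\varepsilon(\alpha)$: optimal dual potentials in $\mathcal C(\mathcal X)$ exist, and $f\in\mathcal C(\mathcal X)$ is one if and only if $f=\varepsilon\log\frac{d\mu_\alpha}{d\alpha}$ $\alpha$-almost everywhere. 3. $F_\varepsilon$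 is strictly convex and weak* continuous on $\mathcal M^+(\mathcal X)$. (This holds for every entropy function $\phi$, in particular for those of balanced transport, Kullback–Leibler, Range, Total Variation, Berg and power entropies.) 4. At every $\alpha\ne 0$ there is a unique $\nabla F_\varepsilon(\alpha)\in\mathcal C(\mathcal X)$ such that, for every finite signed measure $\delta$, $F_\varepsilon(\alpha+t\delta)=F_\varepsilon(\alpha)+t\langle\delta,\nabla F_\varepsilon(\alpha)\rangle+o(t)$ as $t\to 0$ among the $t$ with $\alpha+t\delta\in\mathcal M^+(\mathcal X)$. The Hausdorff divergence $$H_\varepsilon(\alpha,\beta)=\langle\alpha-\beta,\nabla F_\varepsilon(\alpha)-\nabla F_\varepsilon(\beta)\rangle$$ is positive definite on non-zero measures: for all non-zero $\alpha,\beta\in\mathcal M^+(\mathcal X)$, $H_\varepsilon(\alpha,\beta)\ge 0$, with equality if and only if $\alpha=\beta$. -/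

import Mathlib

open MeasureTheory Filter Topology
open scoped NNReal ENNReal MeasureTheory

noncomputable section

namespace UnbalancedOT

/-- Entropy functions `φ : [0, ∞) → [0, ∞]`: convex, lower semicontinuous, `φ 1 = 0`. -/
structure IsEntropyFunction (φ : ℝ≥0 → ℝ≥0∞) : Prop where
  convex : ConvexOn ℝ≥0 Set.univ φ
  lsc : LowerSemicontinuous φ
  one : φ 1 = 0

/-- The Legendre conjugate `φ*(q) = sup_{p ≥ 0} (p q - φ p)`, on extended reals. For `φ` an entropy
function the same formula gives the limit values `φ*(+∞) = +∞` and `φ*(-∞) = -φ(0)`. -/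
def conj (φ : ℝ≥0 → ℝ≥0∞) (q : EReal) : EReal :=
  ⨆ p : ℝ≥0, (((p : ℝ) : EReal) * q - ((φ p : ℝ≥0∞) : EReal))

variable {X : Type*} [MetricSpace X] [MeasurableSpace X]

/-- Integral of an extended real function, as the difference of the integrals of its positive and
negative parts (the latter is finite wherever this is used below). -/
def erealIntegral (α : Measure X) (g : X → EReal) : EReal :=
  ((∫⁻ x, (g x).toENNReal ∂α : ℝ≥0∞) : EReal) - ((∫⁻ x, (-g x).toENNReal ∂α : ℝ≥0∞) : EReal)

/-- The kernel `k_ε = exp (-C / ε)`. -/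
def gibbsKernel (C : C(X × X, ℝ)) (ε : ℝ) : C(X × X, ℝ) :=
  ⟨fun z => Real.exp (-C z / ε), by fun_prop⟩

/-- A kernel is positive if `∬ k(x, y) dσ(x) dσ(y) ≥ 0` for every finite signed measure `σ`. -/
def IsPositiveKernel (k : C(X × X, ℝ)) : Prop :=
  ∀ σ : SignedMeasure X, 0 ≤ ∫ᵛ x, (∫ᵛ y, k (x, y) ∂<•σ) ∂<•σ

/-- A kernel is universal if the functions `x ↦ k(x, y)`, `y ∈ X`, span a dense subspace of the
continuous functions (with the uniform norm, `X` being compact). -/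
def IsUniversalKernel (k : C(X × X, ℝ)) : Prop :=
  Dense (Submodule.span ℝ {g : C(X, ℝ) | ∃ y, ∀ x, g x = k (x, y)} : Set C(X, ℝ))

/-- The dual functional `f ↦ ⟨α, -φ*(-f)⟩ - ε/2 ⟨α ⊗ α, exp ((f ⊕ f - C) / ε)⟩`. -/
def dualFunctional (φ : ℝ≥0 → ℝ≥0∞) (C : C(X × X, ℝ)) (ε : ℝ) (α : FiniteMeasure X)
    (f : C(X, ℝ)) : EReal :=
  -erealIntegral (α : Measure X) (fun x => conj φ (-((f x : ℝ) : EReal))) -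
    ((ε / 2 * ∫ z : X × X, Real.exp ((f z.1 + f z.2 - C z) / ε)
      ∂((α : Measure X).prod (α : Measure X)) : ℝ) : EReal)

/-- The Sinkhorn entropy `F_ε(α)`. -/
def sinkhornEntropy (φ : ℝ≥0 → ℝ≥0∞) (C : C(X × X, ℝ)) (ε : ℝ) (α : FiniteMeasure X) : EReal :=
  -⨆ f : C(X, ℝ), dualFunctional φ C ε α f

/-- `f` is an optimal (symmetric) dual potential for `F_ε(α)`. -/
def IsOptimalPotential (φ : ℝ≥0 → ℝ≥0∞) (C : C(X × X, ℝ)) (ε : ℝ) (α : FiniteMeasure X)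
    (f : C(X, ℝ)) : Prop :=
  ∀ g : C(X, ℝ), dualFunctional φ C ε α g ≤ dualFunctional φ C ε α f

/-- The extended real function `ε log (dμ/dα)`, with `log 0 = -∞`; here `dμ/dα` is the density of
the absolutely continuous part of `μ` in its Lebesgue decomposition with respect to `α`. -/
def logDensity (ε : ℝ) (α μ : FiniteMeasure X) (x : X) : EReal :=
  (ε : EReal) * ENNReal.log ((μ : Measure X).rnDeriv (α : Measure X) x)

/-- The functional `E_ε(α, μ) = ⟨α, φ*(-ε log (dμ/dα))⟩ + ε/2 ⟨μ, k_ε ⋆ μ⟩`. -/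
def primalFunctional (φ : ℝ≥0 → ℝ≥0∞) (C : C(X × X, ℝ)) (ε : ℝ) (α μ : FiniteMeasure X) : EReal :=
  erealIntegral (α : Measure X) (fun x => conj φ (-logDensity ε α μ x)) +
    ((ε / 2 * ∫ x, (∫ y, gibbsKernel C ε (x, y) ∂(μ : Measure X)) ∂(μ : Measure X) : ℝ) : EReal)

/-- `p` is the gradient at `α`, in the sense of measures, of a functional `F` on positive measures:
`F (α + t δ) = F α + t ⟨δ, p⟩ + o(t)` for every signed measure `δ`, as `t → 0` among those `t` for
which `α + t δ` is a positive measure (which is then `β t`). -/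
def HasMeasureGradientAt (F : FiniteMeasure X → ℝ) (α : FiniteMeasure X) (p : C(X, ℝ)) : Prop :=
  ∀ (δ : SignedMeasure X) (β : ℝ → FiniteMeasure X),
    (fun t : ℝ => F (β t) - F α - t * ∫ᵛ x, p x ∂<•δ)
      =o[𝓝[{t : ℝ | (β t : Measure X).toSignedMeasure =
        (α : Measure X).toSignedMeasure + t • δ}] 0] (fun t : ℝ => t)

open Classical in
/-- The gradient `∇F(α)` (zero if `F` is not differentiable at `α`). -/
def measureGradient (F : FiniteMeasure X → ℝ) (α : FiniteMeasure X) : C(X, ℝ) :=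
  if h : ∃ p, HasMeasureGradientAt F α p then h.choose else 0

/-- The Hausdorff divergence `H_ε(α, β) = ⟨α - β, ∇F_ε(α) - ∇F_ε(β)⟩`. -/
def hausdorffDivergence (φ : ℝ≥0 → ℝ≥0∞) (C : C(X × X, ℝ)) (ε : ℝ) (α β : FiniteMeasure X) : ℝ :=
  ∫ᵛ x, (measureGradient (fun γ => (sinkhornEntropy φ C ε γ).toReal) α x -
      measureGradient (fun γ => (sinkhornEntropy φ C ε γ).toReal) β x)
    ∂<•((α : Measure X).toSignedMeasure - (β : Measure X).toSignedMeasure)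

end UnbalancedOT

end

noncomputable section

set_option linter.unusedSectionVars false

namespace UnbalancedOT

/-! ### The scalar minimisation problem -/

/-! Substituting `μ = exp (f / ε) α` turns the dual functional into minus the primal one, so
`F_ε(α)` is the infimum of the primal functional over measures with continuous log-density.
Everything rests on a continuous solution `f` of the Sinkhorn equation: for each `x`, `f x`
minimises `u ↦ φ*(-u) + ε c exp (u / ε)` with `c = (k ⋆ μ)(x)`, where `μ` depends on `f`. As a
function of `l = -ε log c`, the scalar minimiser is monotone and 1-Lipschitz, while `softmin` is
antitone and nonexpansive in `f`. For `α ≠ 0`, `f` is thus a fixed point of an antitone nonexpansive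
map with equicontinuous range, provided by `exists_fixedPoint_of_antitone`.

Let `p x` be the minimal scalar value. Integrating the resulting pointwise inequality along any
competitor and completing the square in the energy (`le_primalFunctional`) bounds the primal
functional from below, with remainder `ε / 2` times a squared kernel distance. A positive universal
kernel separates measures (`eq_of_energyDist_eq_zero`), so `exp (f / ε) α` is the only minimiser.

The same inequality, with `p` taken at `α ≠ 0` but integrated against another `β`, makes `p` a
subgradient of `F_ε` at `α`, strict away from `α` (`add_le_toReal`). Testing the problem for `β`
with `exp (f / ε) β` gives an upper bound whose error is quadratic in `β - α` (`toReal_le`). The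
strict lower bound yields strict convexity and positivity of the Hausdorff divergence; the two
bounds together yield the gradient and weak* continuity at nonzero measures. Continuity at zero uses
a comparison with small point masses (`exists_mul_mass_sub_le_toReal`). -/

theorem conj_neg_le_coe_iff {φ : ℝ≥0 → ℝ≥0∞} {s h : ℝ} :
    conj φ (-(s : EReal)) ≤ (h : EReal) ↔
      ∀ p : ℝ≥0, φ p ≠ ⊤ → -(p * s) - (φ p).toReal ≤ h := by
  unfold conj
  rw [iSup_le_iff]
  refine forall_congr' fun p => ?_
  by_cases hp : φ p = ⊤
  · simp [hp, sub_eq_add_neg]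
  · lift φ p to ℝ≥0 using hp with r
    have : (((p : ℝ) : EReal) * -(s : EReal) - (((r : ℝ≥0) : ℝ≥0∞) : EReal))
        = ((-(p * s) - (r : ℝ) : ℝ) : EReal) := by
      rw [← EReal.coe_neg, ← EReal.coe_mul, ← EReal.coe_ennreal_toReal ENNReal.coe_ne_top, ← EReal.coe_sub]
      simp
    rw [this, EReal.coe_le_coe_iff]
    simp

variable {φ : ℝ≥0 → ℝ≥0∞} {ε : ℝ}

/-- The term `p = 1` of the supremum. It excludes the value `-∞` and gives coercivity of `u ↦
φ*(-u)` as `u → -∞`. -/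
theorem neg_le_conj_neg (hφ : φ 1 = 0) (q : EReal) : q ≤ conj φ q := by
  refine le_trans (le_of_eq ?_) (le_iSup _ 1)
  simp [hφ]

theorem conj_zero (hφ : φ 1 = 0) : conj φ 0 = 0 := by
  refine le_antisymm (iSup_le fun p => ?_) (neg_le_conj_neg hφ 0)
  simp [EReal.coe_ennreal_nonneg]

theorem conj_neg_ne_bot (hφ : φ 1 = 0) (s : ℝ) : conj φ (-(s : EReal)) ≠ ⊥ := by
  refine ne_of_gt (lt_of_lt_of_le ?_ (neg_le_conj_neg hφ _))
  rw [← EReal.coe_neg]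
  exact EReal.bot_lt_coe _

theorem conj_top (hφ : φ 1 = 0) : conj φ ⊤ = ⊤ :=
  top_le_iff.1 (neg_le_conj_neg hφ ⊤)

/-- A supremum of affine functions is convex; bounds `u`, `v` replace the values because these may
be infinite. -/
theorem conj_neg_convex {s t u v a b : ℝ} (hs : conj φ (-(s : EReal)) ≤ (u : EReal))
    (ht : conj φ (-(t : EReal)) ≤ (v : EReal)) (ha : 0 ≤ a) (hb : 0 ≤ b) (hab : a + b = 1) :
    conj φ (-((a * s + b * t : ℝ) : EReal)) ≤ ((a * u + b * v : ℝ) : EReal) := by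
  rw [conj_neg_le_coe_iff] at *
  intro p hp
  have h1 := mul_le_mul_of_nonneg_left (hs p hp) ha
  have h2 := mul_le_mul_of_nonneg_left (ht p hp) hb
  have : (φ p).toReal = a * (φ p).toReal + b * (φ p).toReal := by rw [← add_mul, hab, one_mul]
  rw [this]
  linarith

/-- `s` minimises `u ↦ φ*(-u) + ε c exp (u / ε)`, and `h = φ*(-s)`. -/
structure IsScalarMin (φ : ℝ≥0 → ℝ≥0∞) (ε c s h : ℝ) : Prop where
  eq : conj φ (-(s : EReal)) = (h : EReal)
  le : ∀ u v : ℝ, conj φ (-(u : EReal)) ≤ (v : EReal) →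
    h + ε * c * Real.exp (s / ε) ≤ v + ε * c * Real.exp (u / ε)

theorem exists_isScalarMin (hφ : φ 1 = 0) (hε : 0 < ε) {c : ℝ} (hc : 0 < c) :
    ∃ s h, IsScalarMin φ ε c s h := by
  -- Pairs of a point `u` and a bound for the objective at `u`, cut at height `ε c`, the objective
  -- at `u = 0`. Lower semicontinuity becomes closedness of this set, and infinite values of `φ*`
  -- need no separate treatment.
  let E : Set (ℝ × ℝ) := {z | ∀ p : ℝ≥0, φ p ≠ ⊤ →
    -(p * z.1) - (φ p).toReal ≤ z.2 - ε * c * Real.exp (z.1 / ε)} ∩ {z | z.2 ≤ ε * c}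
  have hE : ∀ z : ℝ × ℝ, z ∈ E ↔ conj φ (-(z.1 : EReal)) ≤
      ((z.2 - ε * c * Real.exp (z.1 / ε) : ℝ) : EReal) ∧ z.2 ≤ ε * c := by
    intro z
    rw [conj_neg_le_coe_iff]
    rfl
  have hclosed : IsClosed E := by
    refine IsClosed.inter ?_ (isClosed_le (by fun_prop) (by fun_prop))
    simp only [Set.ofPred_forall]
    exact isClosed_iInter fun p => isClosed_iInter fun hp =>
      isClosed_le (by fun_prop) (by fun_prop)
  have hlow : ∀ z ∈ E, -z.1 ≤ z.2 - ε * c * Real.exp (z.1 / ε) := by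
    intro z hz
    have := hz.1 1 (by simp [hφ])
    simpa [hφ] using this
  have hεc : 0 < ε * c := mul_pos hε hc
  have hsub : E ⊆ Set.Icc (-(ε * c)) (2 * ε / c) ×ˢ Set.Icc (-(2 * ε / c)) (ε * c) := by
    intro z hz
    have h1 := hlow z hz
    have h2 : z.2 ≤ ε * c := hz.2
    have h3 := Real.exp_pos (z.1 / ε)
    -- Membership in `E` forces `ε c exp (u / ε) ≤ ε c + u`, but for `u > 2 ε / c` the quadratic
    -- Taylor term on the left alone exceeds `u`.
    have h4 : z.1 ≤ 2 * ε / c := by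
      by_contra! hlt
      have hz1 : 0 < z.1 := lt_trans (by positivity) hlt
      have h5 := Real.quadratic_le_exp_of_nonneg (x := z.1 / ε) (by positivity)
      have h6 := mul_le_mul_of_nonneg_left h5 hεc.le
      have h7 : ε * c * (1 + z.1 / ε + (z.1 / ε) ^ 2 / 2) =
        ε * c + c * z.1 + z.1 * (c * z.1 / (2 * ε)) := by field_simp
      have h8 : 1 < c * z.1 / (2 * ε) := by
        rw [lt_div_iff₀ (by positivity)]
        rw [div_lt_iff₀ hc] at hlt
        linarith
      have h9 : z.1 * 1 < z.1 * (c * z.1 / (2 * ε)) := mul_lt_mul_of_pos_left h8 hz1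
      have h10 : 0 < c * z.1 := mul_pos hc hz1
      linarith
    have h5 := mul_pos hεc h3
    exact ⟨⟨by linarith, h4⟩, ⟨by linarith, h2⟩⟩
  have hcomp : IsCompact E := (isCompact_Icc.prod isCompact_Icc).of_isClosed_subset hclosed hsub
  have hne : ((0, ε * c) : ℝ × ℝ) ∈ E := by
    rw [hE]
    simp [conj_zero hφ]
  obtain ⟨z, hz, hmin⟩ := hcomp.exists_isMinOn ⟨_, hne⟩ continuous_snd.continuousOn
  have hle : ∀ u v : ℝ, conj φ (-(u : EReal)) ≤ (v : EReal) →
      z.2 ≤ v + ε * c * Real.exp (u / ε) := by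
    intro u v huv
    by_cases h : v + ε * c * Real.exp (u / ε) ≤ ε * c
    · have hmem : ((u, v + ε * c * Real.exp (u / ε)) : ℝ × ℝ) ∈ E := by
        rw [hE]
        exact ⟨by simpa using huv, h⟩
      exact hmin hmem
    · exact hz.2.trans (not_le.1 h).le
  have hz1 := ((hE z).1 hz).1
  have htop : conj φ (-(z.1 : EReal)) ≠ ⊤ := ne_top_of_le_ne_top (EReal.coe_ne_top _) hz1
  have hh := EReal.coe_toReal htop (conj_neg_ne_bot hφ z.1)
  refine ⟨z.1, (conj φ (-(z.1 : EReal))).toReal, hh.symm, fun u v huv => ?_⟩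
  have h1 := hle u v huv
  rw [← hh, EReal.coe_le_coe_iff] at hz1
  linarith

/-- The optimality condition `-c exp (s / ε) ∈ ∂(u ↦ φ*(-u))(s)`. -/
theorem IsScalarMin.subgradient (hε : 0 < ε) {c s h : ℝ} (H : IsScalarMin φ ε c s h) {u v : ℝ}
    (huv : conj φ (-(u : EReal)) ≤ (v : EReal)) :
    h - c * Real.exp (s / ε) * (u - s) ≤ v := by
  -- Along the segment from `s` to `u`, convexity bounds `φ*(-·)` by its chord, so `q` has a minimum
  -- over `[0, 1]` at `0`; its right derivative there is nonnegative.
  let q : ℝ → ℝ := fun t => t * (v - h) + ε * c * Real.exp ((s + t * (u - s)) / ε)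
  have hq : HasDerivAt q (1 * (v - h) + ε * c * (Real.exp ((s + 0 * (u - s)) / ε) *
      ((1 * (u - s)) / ε))) 0 :=
    ((hasDerivAt_id (0 : ℝ)).mul_const (v - h)).add
      (((((hasDerivAt_id (0 : ℝ)).mul_const (u - s)).const_add s).div_const ε).exp.const_mul (ε * c))
  have hlim := hq.tendsto_slope_zero_right
  have hnonneg : ∀ᶠ t in 𝓝[>] (0 : ℝ), 0 ≤ t⁻¹ • (q (0 + t) - q 0) := by
    filter_upwards [Ioo_mem_nhdsGT (zero_lt_one (α := ℝ))] with t ht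
    have hconv := conj_neg_convex H.eq.le huv (sub_nonneg.2 ht.2.le) ht.1.le (sub_add_cancel 1 t)
    have h1 := H.le _ _ hconv
    have h2 : (1 - t) * s + t * u = s + t * (u - s) := by ring
    rw [h2] at h1
    refine mul_nonneg (inv_nonneg.2 ht.1.le) ?_
    simp only [q, zero_add, zero_mul, add_zero]
    linarith
  have h0 := ge_of_tendsto hlim hnonneg
  have h1 : ε * c * (Real.exp ((s + 0 * (u - s)) / ε) * ((1 * (u - s)) / ε)) =
      c * Real.exp (s / ε) * (u - s) := by
    rw [zero_mul, add_zero]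
    field_simp
  rw [h1] at h0
  linarith

/-- Subgradients of a convex function increase. Those at `s < s'` are `-exp ((s - l) / ε)` and `-exp
((s' - l') / ε)`, hence `s' - l' ≤ s - l`. Monotonicity, the Lipschitz bound and uniqueness of the
minimiser all come from this. -/
theorem IsScalarMin.le_add_of_le (hε : 0 < ε) {l l' s s' h h' : ℝ}
    (H : IsScalarMin φ ε (Real.exp (-l / ε)) s h)
    (H' : IsScalarMin φ ε (Real.exp (-l' / ε)) s' h') (hs : s < s') : s' - s ≤ l' - l := by
  have h1 := H.subgradient hε H'.eq.le
  have h2 := H'.subgradient hε H.eq.le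
  rw [← Real.exp_add, ← add_div] at h1 h2
  by_contra! hlt
  have h3 : Real.exp ((-l + s) / ε) < Real.exp ((-l' + s') / ε) := by
    rw [Real.exp_lt_exp]
    exact div_lt_div_of_pos_right (by linarith) hε
  nlinarith

theorem exists_scalarMin_fun (hφ : φ 1 = 0) (hε : 0 < ε) :
    ∃ S H : ℝ → ℝ, (∀ l, IsScalarMin φ ε (Real.exp (-l / ε)) (S l) (H l)) ∧ Monotone S ∧
      (∀ l l', |S l - S l'| ≤ |l - l'|) ∧ Continuous H := by
  choose S H hSH using fun l : ℝ => exists_isScalarMin hφ hε (Real.exp_pos (-l / ε))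
  have hlip : ∀ l l', |S l - S l'| ≤ |l - l'| := by
    intro l l'
    rcases lt_trichotomy (S l) (S l') with h | h | h
    · have := (hSH l).le_add_of_le hε (hSH l') h
      rw [abs_sub_comm, abs_sub_comm l, abs_of_pos (sub_pos.2 h)]
      exact this.trans (le_abs_self _)
    · simp [h]
    · have := (hSH l').le_add_of_le hε (hSH l) h
      rw [abs_of_pos (sub_pos.2 h)]
      exact this.trans (le_abs_self _)
  have hmono : Monotone S := by
    intro l l' hl
    by_contra! h
    have := (hSH l').le_add_of_le hε (hSH l) h
    linarith
  have hScont : Continuous S := by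
    refine (LipschitzWith.of_dist_le_mul (K := 1) fun l l' => ?_).continuous
    simpa [Real.dist_eq] using hlip l l'
  refine ⟨S, H, hSH, hmono, hlip, continuous_iff_continuousAt.2 fun l => ?_⟩
  -- The values `φ*(-S l)` are squeezed between the subgradient inequalities at `S l` and at `S l'`,
  -- whose slopes depend continuously on `l'`.
  have hlow : ∀ l', H l - Real.exp (-l / ε) * Real.exp (S l / ε) * (S l' - S l) ≤ H l' :=
    fun l' => (hSH l).subgradient hε (hSH l').eq.le
  have hup : ∀ l', H l' ≤ H l + Real.exp (-l' / ε) * Real.exp (S l' / ε) * (S l - S l') := by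
    intro l'
    have := (hSH l').subgradient hε (hSH l).eq.le
    linarith
  refine tendsto_of_tendsto_of_tendsto_of_le_of_le ?_ ?_ hlow hup
  · have : Continuous fun l' => H l - Real.exp (-l / ε) * Real.exp (S l / ε) * (S l' - S l) := by
      fun_prop
    simpa using this.tendsto l
  · have : Continuous fun l' =>
        H l + Real.exp (-l' / ε) * Real.exp (S l' / ε) * (S l - S l') := by
      fun_prop
    simpa using this.tendsto l

/-! ### Integrals of extended real functions -/

section ERealIntegral

variable {X : Type*} [MeasurableSpace X] {α : Measure X}

theorem erealIntegral_congr_ae {g g' : X → EReal} (h : g =ᵐ[α] g') :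
    erealIntegral α g = erealIntegral α g' := by
  unfold erealIntegral
  rw [lintegral_congr_ae (h.mono fun x hx => congrArg EReal.toENNReal hx),
    lintegral_congr_ae (h.mono fun x hx => congrArg (fun z : EReal => (-z).toENNReal) hx)]

theorem erealIntegral_coe {h : X → ℝ} (hh : Integrable h α) :
    erealIntegral α (fun x => (h x : EReal)) = ((∫ x, h x ∂α : ℝ) : EReal) := by
  have hneg : Integrable (fun x => -h x) α := hh.neg
  have h1 : ∫⁻ x, ENNReal.ofReal (h x) ∂α ≠ ⊤ := hh.lintegral_lt_top.ne
  have h2 : ∫⁻ x, ENNReal.ofReal (-h x) ∂α ≠ ⊤ := hneg.lintegral_lt_top.ne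
  unfold erealIntegral
  simp only [← EReal.coe_neg, EReal.real_coe_toENNReal]
  rw [integral_eq_lintegral_pos_part_sub_lintegral_neg_part hh, EReal.coe_sub,
    EReal.coe_ennreal_toReal h1, EReal.coe_ennreal_toReal h2]

theorem erealIntegral_mono {g g' : X → EReal} (h : ∀ᵐ x ∂α, g x ≤ g' x) :
    erealIntegral α g ≤ erealIntegral α g' := by
  unfold erealIntegral
  refine EReal.sub_le_sub ?_ ?_
  · rw [EReal.coe_ennreal_le_coe_ennreal_iff]
    exact lintegral_mono_ae (h.mono fun x hx => EReal.toENNReal_le_toENNReal hx)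
  · rw [EReal.coe_ennreal_le_coe_ennreal_iff]
    exact lintegral_mono_ae
      (h.mono fun x hx => EReal.toENNReal_le_toENNReal (EReal.neg_le_neg_iff.2 hx))

end ERealIntegral

/-! ### Energies of kernels -/

section Energy

variable {X : Type*} [MetricSpace X] [CompactSpace X] [MeasurableSpace X] [BorelSpace X]

theorem integrable_of_continuous {Y : Type*} [TopologicalSpace Y] [CompactSpace Y]
    [MeasurableSpace Y] [OpensMeasurableSpace Y] [SecondCountableTopology Y]
    {g : Y → ℝ} (hg : Continuous g) (μ : Measure Y) [IsFiniteMeasure μ] : Integrable g μ := by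
  exact hg.integrable_of_hasCompactSupport (HasCompactSupport.of_compactSpace g)

theorem integral_signed_sub {g : X → ℝ} (hg : Continuous g) (μ ν : Measure X)
    [IsFiniteMeasure μ] [IsFiniteMeasure ν] :
    ∫ᵛ x, g x ∂<•(μ.toSignedMeasure - ν.toSignedMeasure) = ∫ x, g x ∂μ - ∫ x, g x ∂ν := by
  rw [VectorMeasure.integral_sub_vectorMeasure, VectorMeasure.integral_toSignedMeasure,
    VectorMeasure.integral_toSignedMeasure]
  · simpa [VectorMeasure.Integrable] using integrable_of_continuous hg μ
  · simpa [VectorMeasure.Integrable] using integrable_of_continuous hg ν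

theorem exists_eq_toSignedMeasure_sub {X : Type*} [MeasurableSpace X] (δ : SignedMeasure X) :
    ∃ μ ν : FiniteMeasure X,
      δ = (μ : Measure X).toSignedMeasure - (ν : Measure X).toSignedMeasure :=
  ⟨⟨δ.toJordanDecomposition.posPart, inferInstance⟩,
    ⟨δ.toJordanDecomposition.negPart, inferInstance⟩,
    (SignedMeasure.toSignedMeasure_toJordanDecomposition δ).symm⟩

theorem integral_of_toSignedMeasure_eq {g : X → ℝ} (hg : Continuous g) {α β μ ν : Measure X}
    [IsFiniteMeasure α] [IsFiniteMeasure β] [IsFiniteMeasure μ] [IsFiniteMeasure ν] {t : ℝ}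
    (h : β.toSignedMeasure =
      α.toSignedMeasure + t • (μ.toSignedMeasure - ν.toSignedMeasure)) :
    ∫ x, g x ∂β = ∫ x, g x ∂α + t * (∫ x, g x ∂μ - ∫ x, g x ∂ν) := by
  have hi : ∀ ρ : Measure X, [IsFiniteMeasure ρ] →
      VectorMeasure.Integrable ρ.toSignedMeasure g := by
    intro ρ _
    simpa [VectorMeasure.Integrable] using integrable_of_continuous hg ρ
  rw [← VectorMeasure.integral_toSignedMeasure (μ := β), h,
    VectorMeasure.integral_add_vectorMeasure (hi α)
      (((hi μ).sub_vectorMeasure (hi ν)).smul_vectorMeasure t),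
    VectorMeasure.integral_smul_vectorMeasure, integral_signed_sub hg,
    VectorMeasure.integral_toSignedMeasure, smul_eq_mul]

/-- The function `x ↦ ∫ k(x, y) dμ(y)`. -/
def kernelPotential (k : C(X × X, ℝ)) (μ : Measure X) [IsFiniteMeasure μ] : C(X, ℝ) :=
  ⟨fun x => ∫ y, k (x, y) ∂μ, by
    have h : Continuous (Function.uncurry fun x y => k (x, y)) := k.continuous
    simpa using continuous_parametric_integral_of_continuous (μ := μ) h isCompact_univ⟩

theorem kernelPotential_apply (k : C(X × X, ℝ)) (μ : Measure X) [IsFiniteMeasure μ] (x : X) :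
    kernelPotential k μ x = ∫ y, k (x, y) ∂μ := rfl

/-- The energy `∬ k(x, y) dμ(x) dν(y)`. -/
def energy (k : C(X × X, ℝ)) (μ ν : Measure X) : ℝ := ∫ x, ∫ y, k (x, y) ∂ν ∂μ

variable {k : C(X × X, ℝ)} {μ ν ρ : Measure X} [IsFiniteMeasure μ] [IsFiniteMeasure ν]
  [IsFiniteMeasure ρ]

theorem energy_eq_integral_kernelPotential :
    energy k μ ν = ∫ x, kernelPotential k ν x ∂μ := rfl

theorem energy_eq_integral_prod : energy k μ ν = ∫ z, k z ∂(μ.prod ν) :=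
  (integral_prod _ (integrable_of_continuous k.continuous (μ.prod ν))).symm

theorem energy_comm (hk : ∀ x y, k (x, y) = k (y, x)) : energy k μ ν = energy k ν μ := by
  unfold energy
  rw [integral_integral_swap (f := fun x y => k (x, y))
    (integrable_of_continuous k.continuous (μ.prod ν))]
  exact integral_congr_ae (.of_forall fun x => integral_congr_ae (.of_forall fun y => hk y x))

theorem energy_add_left : energy k (μ + ν) ρ = energy k μ ρ + energy k ν ρ := by
  simp only [energy_eq_integral_kernelPotential]
  exact integral_add_measure (integrable_of_continuous (map_continuous _) _)
    (integrable_of_continuous (map_continuous _) _)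

theorem energy_add_right : energy k ρ (μ + ν) = energy k ρ μ + energy k ρ ν := by
  simp only [energy_eq_integral_kernelPotential]
  rw [← integral_add (integrable_of_continuous (map_continuous _) _)
    (integrable_of_continuous (map_continuous _) _)]
  refine integral_congr_ae (.of_forall fun x => ?_)
  exact integral_add_measure (integrable_of_continuous (by fun_prop) _)
    (integrable_of_continuous (by fun_prop) _)

theorem energy_smul_left (c : ℝ≥0) : energy k (c • μ) ρ = c * energy k μ ρ := by
  simp [energy, NNReal.smul_def]

theorem energy_smul_right (c : ℝ≥0) : energy k ρ (c • μ) = c * energy k ρ μ := by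
  simp [energy, NNReal.smul_def, integral_const_mul]

theorem energy_dirac_right (y : X) : energy k μ (Measure.dirac y) = ∫ x, k (x, y) ∂μ := by
  simp [energy]

/-- The squared kernel distance `∬ k d(μ - ν) d(μ - ν)`. -/
def energyDist (k : C(X × X, ℝ)) (μ ν : Measure X) : ℝ :=
  energy k μ μ - 2 * energy k μ ν + energy k ν ν

theorem energyDist_nonneg (hk : ∀ x y, k (x, y) = k (y, x)) (hpos : IsPositiveKernel k) :
    0 ≤ energyDist k μ ν := by
  have h := hpos (μ.toSignedMeasure - ν.toSignedMeasure)
  have h1 : ∀ x, ∫ᵛ y, k (x, y) ∂<•(μ.toSignedMeasure - ν.toSignedMeasure) =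
      kernelPotential k μ x - kernelPotential k ν x :=
    fun x => integral_signed_sub (by fun_prop) μ ν
  simp only [h1] at h
  rw [integral_signed_sub (by fun_prop),
    integral_sub (integrable_of_continuous (map_continuous _) _)
      (integrable_of_continuous (map_continuous _) _),
    integral_sub (integrable_of_continuous (map_continuous _) _)
      (integrable_of_continuous (map_continuous _) _)] at h
  simp only [← energy_eq_integral_kernelPotential] at h
  rw [energy_comm (μ := ν) (ν := μ) hk] at h
  unfold energyDist
  linarith

/-- The squared distance vanishes at `μ` and stays nonnegative along `μ + t δ_y`, `t ≥ 0`, so its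
first-order term in `t` cannot be negative. -/
theorem integral_kernel_le_of_energyDist_eq_zero (hk : ∀ x y, k (x, y) = k (y, x))
    (hpos : IsPositiveKernel k) (h : energyDist k μ ν = 0) (y : X) :
    ∫ x, k (x, y) ∂ν ≤ ∫ x, k (x, y) ∂μ := by
  have key : ∀ t : ℝ, 0 ≤ t → 0 ≤ 2 * t * (∫ x, k (x, y) ∂μ - ∫ x, k (x, y) ∂ν) +
      t ^ 2 * energy k (Measure.dirac y) (Measure.dirac y) := by
    intro t ht
    lift t to ℝ≥0 using ht
    have h0 := energyDist_nonneg (μ := μ + t • Measure.dirac y) (ν := ν) hk hpos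
    unfold energyDist at h h0
    simp only [energy_add_left, energy_add_right, energy_smul_left, energy_smul_right] at h0
    rw [energy_comm (μ := Measure.dirac y) (ν := μ) hk,
      energy_comm (μ := Measure.dirac y) (ν := ν) hk, energy_dirac_right (μ := μ),
      energy_dirac_right (μ := ν)] at h0
    linarith
  set e := energy k (Measure.dirac y) (Measure.dirac y)
  by_contra! hlt
  set d := ∫ x, k (x, y) ∂ν - ∫ x, k (x, y) ∂μ with hd
  have hdpos : 0 < d := by linarith
  -- With this `t` the quadratic term is at most `t d`, too small to compensate the linear term `-2
  -- t d`.
  have htpos : 0 < d / (|e| + 1) := by positivity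
  have h1 := key _ htpos.le
  set t := d / (|e| + 1) with ht
  have h2 : t * (|e| + 1) = d := by rw [ht]; field_simp
  have h3 : t ^ 2 * e ≤ t * d := by
    have : t ^ 2 * e ≤ t ^ 2 * (|e| + 1) :=
      mul_le_mul_of_nonneg_left (by linarith [le_abs_self e]) (sq_nonneg t)
    calc _ ≤ t ^ 2 * (|e| + 1) := this
      _ = t * d := by rw [← h2]; ring
  have h4 : 0 < t * d := mul_pos htpos hdpos
  have h5 : 2 * t * (∫ x, k (x, y) ∂μ - ∫ x, k (x, y) ∂ν) = -(2 * (t * d)) := by rw [hd]; ring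
  linarith

/-- A positive universal kernel is characteristic. -/
theorem eq_of_energyDist_eq_zero {μ ν : FiniteMeasure X} (hk : ∀ x y, k (x, y) = k (y, x))
    (hpos : IsPositiveKernel k) (huniv : IsUniversalKernel k)
    (h : energyDist k (μ : Measure X) (ν : Measure X) = 0) : μ = ν := by
  have h' : energyDist k (ν : Measure X) (μ : Measure X) = 0 := by
    rw [← h, energyDist, energyDist, energy_comm (μ := (ν : Measure X)) (ν := (μ : Measure X)) hk]
    ring
  have heq : ∀ y, ∫ x, k (x, y) ∂(μ : Measure X) = ∫ x, k (x, y) ∂(ν : Measure X) := fun y =>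
    le_antisymm (integral_kernel_le_of_energyDist_eq_zero hk hpos h' y)
      (integral_kernel_le_of_energyDist_eq_zero hk hpos h y)
  have hcont : ∀ ρ : FiniteMeasure X,
      Continuous fun g : C(X, ℝ) => ∫ x, g x ∂(ρ : Measure X) := by
    intro ρ
    refine (LipschitzWith.of_dist_le_mul (K := ρ.mass) fun f g => ?_).continuous
    rw [Real.dist_eq, ← integral_sub (integrable_of_continuous (map_continuous _) _)
      (integrable_of_continuous (map_continuous _) _)]
    have hb := norm_integral_le_of_norm_le_const (μ := (ρ : Measure X))
      (f := fun x => f x - g x) (C := dist f g)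
      (.of_forall fun x => by rw [← dist_eq_norm]; exact ContinuousMap.dist_apply_le_dist x)
    rw [mul_comm] at hb
    exact hb
  have hall : ∀ g : C(X, ℝ), ∫ x, g x ∂(μ : Measure X) = ∫ x, g x ∂(ν : Measure X) := by
    intro g
    -- Equality of integrals is a closed linear condition valid on the sections `k(·, y)`;
    -- universality extends it to all continuous functions.
    have hclosed : IsClosed {g : C(X, ℝ) |
        ∫ x, g x ∂(μ : Measure X) = ∫ x, g x ∂(ν : Measure X)} :=
      isClosed_eq (hcont μ) (hcont ν)
    refine hclosed.closure_subset_iff.2 (fun g hg => ?_) (huniv g)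
    change ∫ x, g x ∂(μ : Measure X) = ∫ x, g x ∂(ν : Measure X)
    induction hg using Submodule.span_induction with
    | mem g hg =>
      obtain ⟨y, hy⟩ := hg
      simpa only [hy] using heq y
    | zero => simp
    | add f g _ _ hf hg =>
      simp only [ContinuousMap.add_apply]
      rw [integral_add (integrable_of_continuous (map_continuous _) _)
        (integrable_of_continuous (map_continuous _) _),
        integral_add (integrable_of_continuous (map_continuous _) _)
        (integrable_of_continuous (map_continuous _) _), hf, hg]
    | smul c g _ hg =>
      simp only [ContinuousMap.smul_apply, smul_eq_mul, integral_const_mul, hg]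
  exact FiniteMeasure.ext_of_forall_integral_eq fun g => hall g.toContinuousMap

end Energy

/-! ### A fixed point theorem for antitone nonexpansive maps -/

section FixedPoint

variable {X E : Type*} [TopologicalSpace X] [MetricSpace E] {c : X → E}

theorem isCompact_setOf_modulus (hc : Continuous c) (M : ℝ) :
    IsCompact {g : C(X, ℝ) | (∀ x, |g x| ≤ M) ∧ ∀ x y, |g x - g y| ≤ dist (c x) (c y)} := by
  have hcont : ∀ g : X → ℝ, (∀ x y, |g x - g y| ≤ dist (c x) (c y)) → Continuous g := by
    intro g hg
    refine continuous_iff_continuousAt.2 fun x => tendsto_iff_dist_tendsto_zero.2 ?_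
    refine squeeze_zero (fun _ => dist_nonneg) (fun y => hg y x) ?_
    have : Continuous fun y => dist (c y) (c x) := by fun_prop
    simpa using this.tendsto x
  refine ArzelaAscoli.isCompact_of_equicontinuous _ ?_ ?_
  · have himage : ContinuousMap.toFun '' {g : C(X, ℝ) | (∀ x, |g x| ≤ M) ∧
          ∀ x y, |g x - g y| ≤ dist (c x) (c y)} =
        (Set.univ.pi fun _ => Set.Icc (-M) M) ∩
          {g | ∀ x y, |g x - g y| ≤ dist (c x) (c y)} := by
      ext g
      constructor
      · rintro ⟨f, ⟨h1, h2⟩, rfl⟩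
        exact ⟨fun x _ => abs_le.1 (h1 x), h2⟩
      · rintro ⟨h1, h2⟩
        exact ⟨⟨g, hcont g h2⟩, ⟨fun x => abs_le.2 (h1 x trivial), h2⟩, rfl⟩
    rw [himage]
    refine (isCompact_univ_pi fun _ => isCompact_Icc).inter_right ?_
    simp only [Set.ofPred_forall]
    exact isClosed_iInter fun x => isClosed_iInter fun y =>
      isClosed_le (by fun_prop) continuous_const
  · intro x
    rw [Metric.equicontinuousAt_iff_right]
    intro η hη
    obtain ⟨U, hU, hUη⟩ : ∃ U ∈ 𝓝 x, ∀ y ∈ U, dist (c x) (c y) < η := by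
      have : Continuous fun y => dist (c x) (c y) := by fun_prop
      exact ⟨_, this.continuousAt.eventually_lt continuousAt_const (by simpa using hη),
        fun y hy => hy⟩
    filter_upwards [hU] with y hy g
    exact (g.2.2 x y).trans_lt (hUη y hy)

variable [CompactSpace X]

/-- The contractions `r T`, `r < 1`, have fixed points, which are approximate fixed points of `T` as
`r → 1`. Nonexpansiveness alone would let them escape to infinity, as for a translation;
antitonicity bounds them uniformly, and the common modulus then gives compactness. -/
theorem exists_fixedPoint_of_antitone (hc : Continuous c) {T : C(X, ℝ) → C(X, ℝ)}
    (hT : LipschitzWith 1 T) (hanti : Antitone T)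
    (hmod : ∀ f x y, |T f x - T f y| ≤ dist (c x) (c y)) : ∃ f, T f = f := by
  obtain ⟨D, hD⟩ := Metric.isBounded_iff.1 (isCompact_range hc).isBounded
  have hD' : ∀ x y, dist (c x) (c y) ≤ |D| := fun x y =>
    (hD ⟨x, rfl⟩ ⟨y, rfl⟩).trans (le_abs_self D)
  set M := |D| + ‖T 0‖
  set A := {g : C(X, ℝ) | (∀ x, |g x| ≤ M) ∧ ∀ x y, |g x - g y| ≤ dist (c x) (c y)}
  have happrox : ∀ r : ℝ, 0 ≤ r → r < 1 → ∃ f ∈ A, f = r • T f := by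
    intro r hr0 hr1
    have hcontr : ContractingWith r.toNNReal (fun f => r • T f) := by
      refine ⟨by simpa using hr1, LipschitzWith.of_dist_le_mul fun f g => ?_⟩
      rw [dist_eq_norm, ← smul_sub, norm_smul, Real.norm_of_nonneg hr0, Real.coe_toNNReal _ hr0,
        ← dist_eq_norm]
      exact mul_le_mul_of_nonneg_left (by simpa using hT.dist_le_mul f g) hr0
    have hfix := hcontr.fixedPoint_isFixedPt
    set f := hcontr.fixedPoint
    have hf : f = r • T f := hfix.symm
    have hfx : ∀ x, f x = r * T f x := fun x => by
      conv_lhs => rw [hf]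
      rfl
    have hosc : ∀ x y, |f x - f y| ≤ dist (c x) (c y) := by
      intro x y
      rw [hfx x, hfx y, ← mul_sub, abs_mul, abs_of_nonneg hr0]
      exact (mul_le_of_le_one_left (abs_nonneg _) hr1.le).trans (hmod f x y)
    have hT0 : ∀ x, |T 0 x| ≤ ‖T 0‖ := fun x => (T 0).norm_coe_le_norm x
    refine ⟨f, ⟨fun x => ?_, hosc⟩, hf⟩
    have hoscx : ∀ y, |f x - f y| ≤ |D| := fun y => (hosc x y).trans (hD' x y)
    have h0 := hT0 x
    rw [abs_le] at h0 ⊢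
    constructor
    · by_contra! hlt
      -- A value below `-M` and oscillation at most `|D|` make `f` negative everywhere; then `T f ≥
      -- T 0`, which keeps `f = r T f` above `-‖T 0‖`.
      have hneg : f ≤ 0 := fun y => by
        have := (abs_le.1 (hoscx y)).1
        have := norm_nonneg (T 0)
        change f y ≤ 0
        linarith
      have h1 : T 0 x ≤ T f x := hanti hneg x
      have h2 := hfx x
      have h3 : -‖T 0‖ ≤ r * T f x := by
        nlinarith [norm_nonneg (T 0)]
      linarith [abs_nonneg D]
    · by_contra! hlt
      have hneg : 0 ≤ f := fun y => by
        have := (abs_le.1 (hoscx y)).2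
        have := norm_nonneg (T 0)
        change 0 ≤ f y
        linarith
      have h1 : T f x ≤ T 0 x := hanti hneg x
      have h2 := hfx x
      have h3 : r * T f x ≤ ‖T 0‖ := by
        nlinarith [norm_nonneg (T 0)]
      linarith [abs_nonneg D]
  have hne : A.Nonempty := by
    obtain ⟨f, hf, -⟩ := happrox 0 le_rfl one_pos
    exact ⟨f, hf⟩
  -- The displacement `dist (T f) f` attains its minimum on the compact set `A`, and at the fixed
  -- point of `(1 - t) T` it equals `t ‖T g‖`, which is arbitrarily small.
  obtain ⟨f, hfA, hmin⟩ := (isCompact_setOf_modulus hc M).exists_isMinOn hne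
    (f := fun f => dist (T f) f) (hT.continuous.dist continuous_id).continuousOn
  refine ⟨f, dist_le_zero.1 (le_of_forall_pos_le_add fun η hη => ?_)⟩
  have hpos : 0 < ‖T 0‖ + M + 1 := by positivity
  set t := min 1 (η / (‖T 0‖ + M + 1)) with ht
  have ht0 : 0 < t := lt_min one_pos (by positivity)
  obtain ⟨g, hgA, hg⟩ := happrox (1 - t) (sub_nonneg.2 (min_le_left _ _)) (by linarith)
  have hnorm : ‖T g‖ ≤ ‖T 0‖ + M := by
    have h1 := hT.dist_le_mul g 0
    have h2 : ‖g‖ ≤ M := (ContinuousMap.norm_le g (by positivity)).2 hgA.1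
    rw [dist_zero_right, dist_eq_norm] at h1
    have h3 := norm_sub_norm_le (T g) (T 0)
    have : ((1 : ℝ≥0) : ℝ) = 1 := rfl
    rw [this] at h1
    linarith
  calc dist (T f) f ≤ dist (T g) g := hmin hgA
    _ = ‖t • T g‖ := by
      have : T g - g = t • T g := by
        conv_lhs => rw [hg, ← hg]
        nth_rewrite 2 [hg]
        rw [sub_smul, one_smul, sub_sub_cancel]
      rw [dist_eq_norm, this]
    _ = t * ‖T g‖ := by rw [norm_smul, Real.norm_of_nonneg ht0.le]
    _ ≤ η / (‖T 0‖ + M + 1) * (‖T 0‖ + M + 1) :=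
      mul_le_mul (min_le_right _ _) (by linarith) (norm_nonneg _) (by positivity)
    _ = 0 + η := by rw [zero_add, div_mul_cancel₀ _ hpos.ne']

end FixedPoint

/-! ### Existence of potentials -/

section Potential

variable {X : Type*} [MetricSpace X] [CompactSpace X] [MeasurableSpace X] [BorelSpace X]

/-- The measure `exp (f / ε) α`. -/
def gibbsMeasure (ε : ℝ) (f : C(X, ℝ)) (α : FiniteMeasure X) : FiniteMeasure X :=
  ⟨(α : Measure X).withDensity fun x => ENNReal.ofReal (Real.exp (f x / ε)),
    isFiniteMeasure_withDensity_ofReal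
      (integrable_of_continuous (by fun_prop) (α : Measure X)).2⟩

theorem coe_gibbsMeasure (ε : ℝ) (f : C(X, ℝ)) (α : FiniteMeasure X) :
    (gibbsMeasure ε f α : Measure X) =
      (α : Measure X).withDensity fun x => ENNReal.ofReal (Real.exp (f x / ε)) := rfl

theorem integral_gibbsMeasure (ε : ℝ) (f : C(X, ℝ)) (α : FiniteMeasure X) (g : X → ℝ) :
    ∫ x, g x ∂(gibbsMeasure ε f α : Measure X) =
      ∫ x, Real.exp (f x / ε) * g x ∂(α : Measure X) := by
  rw [coe_gibbsMeasure, integral_withDensity_eq_integral_toReal_smul (by fun_prop) (by simp)]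
  simp [ENNReal.toReal_ofReal (Real.exp_pos _).le]

/-- The soft minimum `-ε log ∫ exp ((f(y) - C(x, y)) / ε) dα(y)`. -/
def softmin (C : C(X × X, ℝ)) (ε : ℝ) (α : Measure X) (f : C(X, ℝ)) (x : X) : ℝ :=
  -(ε * Real.log (∫ y, Real.exp ((f y - C (x, y)) / ε) ∂α))

variable {C : C(X × X, ℝ)} {α : Measure X} [IsFiniteMeasure α]

theorem integral_exp_pos_of_ne_zero (hα : α ≠ 0) (f : C(X, ℝ)) (x : X) :
    0 < ∫ y, Real.exp ((f y - C (x, y)) / ε) ∂α := by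
  have : NeZero α := ⟨hα⟩
  exact integral_exp_pos (integrable_of_continuous (by fun_prop) α)

theorem exp_neg_softmin (hε : 0 < ε) (hα : α ≠ 0) (f : C(X, ℝ)) (x : X) :
    Real.exp (-softmin C ε α f x / ε) = ∫ y, Real.exp ((f y - C (x, y)) / ε) ∂α := by
  rw [softmin, neg_neg, mul_div_cancel_left₀ _ hε.ne',
    Real.exp_log (integral_exp_pos_of_ne_zero hα f x)]

/-- Comparing exponents pointwise handles three uses at once: continuity in `x`, nonexpansiveness in
`f`, and antitonicity in `f` (with `d = 0`). -/
theorem softmin_le_add (hε : 0 < ε) (hα : α ≠ 0) {f g : C(X, ℝ)} {x x' : X} {d : ℝ}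
    (h : ∀ y, f y - C (x, y) ≤ g y - C (x', y) + d) :
    softmin C ε α g x' ≤ softmin C ε α f x + d := by
  have h1 : ∫ y, Real.exp ((f y - C (x, y)) / ε) ∂α ≤
      Real.exp (d / ε) * ∫ y, Real.exp ((g y - C (x', y)) / ε) ∂α := by
    rw [← integral_const_mul]
    refine integral_mono (integrable_of_continuous (by fun_prop) α)
      (integrable_of_continuous (by fun_prop) α) fun y => ?_
    change _ ≤ Real.exp (d / ε) * Real.exp _
    rw [← Real.exp_add, Real.exp_le_exp, ← add_div]
    exact div_le_div_of_nonneg_right (by linarith [h y]) hε.le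
  have h2 := Real.log_le_log (integral_exp_pos_of_ne_zero hα f x) h1
  rw [Real.log_mul (Real.exp_pos _).ne' (integral_exp_pos_of_ne_zero hα g x').ne',
    Real.log_exp] at h2
  have h3 := mul_le_mul_of_nonneg_left h2 hε.le
  rw [mul_add, mul_div_cancel₀ _ hε.ne'] at h3
  unfold softmin
  linarith

theorem abs_softmin_sub_le (hε : 0 < ε) (hα : α ≠ 0) (f : C(X, ℝ)) (x x' : X) :
    |softmin C ε α f x - softmin C ε α f x'| ≤ dist (C.curry x) (C.curry x') := by
  have key : ∀ x x' : X, softmin C ε α f x' ≤ softmin C ε α f x +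
      dist (C.curry x) (C.curry x') := by
    intro x x'
    refine softmin_le_add hε hα fun y => ?_
    have h1 := ContinuousMap.dist_apply_le_dist (f := C.curry x) (g := C.curry x') y
    rw [Real.dist_eq] at h1
    have h2 : -(C (x, y) - C (x', y)) ≤ dist (C.curry x) (C.curry x') := (neg_le_abs _).trans h1
    linarith
  have h1 := key x x'
  have h2 := key x' x
  rw [dist_comm] at h2
  rw [abs_le]
  constructor <;> linarith

theorem abs_softmin_sub_le_dist (hε : 0 < ε) (hα : α ≠ 0) (f g : C(X, ℝ)) (x : X) :
    |softmin C ε α f x - softmin C ε α g x| ≤ dist f g := by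
  have key : ∀ f g : C(X, ℝ), softmin C ε α g x ≤ softmin C ε α f x + dist f g := by
    intro f g
    refine softmin_le_add hε hα fun y => ?_
    have h1 := ContinuousMap.dist_apply_le_dist (f := f) (g := g) y
    rw [Real.dist_eq] at h1
    linarith [(le_abs_self _).trans h1]
  have h1 := key f g
  have h2 := key g f
  rw [dist_comm] at h2
  rw [abs_le]
  constructor <;> linarith

theorem continuous_softmin (hε : 0 < ε) (hα : α ≠ 0) (f : C(X, ℝ)) :
    Continuous (softmin C ε α f) := by
  refine continuous_iff_continuousAt.2 fun x => tendsto_iff_dist_tendsto_zero.2 ?_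
  refine squeeze_zero (fun _ => dist_nonneg) (fun y => abs_softmin_sub_le hε hα f y x) ?_
  have : Continuous fun y => dist (C.curry y) (C.curry x) := by fun_prop
  simpa using this.tendsto x

theorem kernelPotential_gibbsMeasure (f : C(X, ℝ)) (α : FiniteMeasure X) (x : X) :
    kernelPotential (gibbsKernel C ε) (gibbsMeasure ε f α : Measure X) x =
      ∫ y, Real.exp ((f y - C (x, y)) / ε) ∂(α : Measure X) := by
  rw [kernelPotential_apply, integral_gibbsMeasure]
  refine integral_congr_ae (.of_forall fun y => ?_)
  change Real.exp _ * Real.exp _ = Real.exp _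
  rw [← Real.exp_add, ← add_div, ← sub_eq_add_neg]

/-- The Sinkhorn equation has a continuous solution. -/
theorem exists_potential (hφ : φ 1 = 0) (hε : 0 < ε) {α : FiniteMeasure X} (hα : α ≠ 0) :
    ∃ f h : C(X, ℝ), ∀ x, IsScalarMin φ ε
      (kernelPotential (gibbsKernel C ε) (gibbsMeasure ε f α : Measure X) x) (f x) (h x) := by
  obtain ⟨S, H, hSH, hmono, hlip, hH⟩ := exists_scalarMin_fun hφ hε
  have hα' : (α : Measure X) ≠ 0 := fun h => hα (Subtype.ext h)
  have hS : Continuous S := by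
    refine (LipschitzWith.of_dist_le_mul (K := 1) fun l l' => ?_).continuous
    simpa [Real.dist_eq] using hlip l l'
  -- Since `exp (-softmin / ε) = k ⋆ (exp (f / ε) α)`, the fixed points of `T` solve the Sinkhorn
  -- equation. The modulus of continuity is that of `x ↦ C(x, ·)`.
  let T : C(X, ℝ) → C(X, ℝ) := fun f =>
    ⟨fun x => S (softmin C ε α f x), hS.comp (continuous_softmin hε hα' f)⟩
  obtain ⟨f, hf⟩ : ∃ f, T f = f := by
    refine exists_fixedPoint_of_antitone (c := C.curry) C.curry.continuous ?_ ?_ ?_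
    · refine LipschitzWith.of_dist_le_mul fun f g => ?_
      rw [NNReal.coe_one, one_mul, ContinuousMap.dist_le dist_nonneg]
      exact fun x => (hlip _ _).trans (abs_softmin_sub_le_dist hε hα' f g x)
    · intro f g hfg x
      refine hmono ?_
      have := softmin_le_add (C := C) (α := α) hε hα' (f := f) (g := g) (x := x) (x' := x) (d := 0)
        fun y => by have : f y ≤ g y := hfg y; linarith
      simpa using this
    · exact fun f x y => (hlip _ _).trans (abs_softmin_sub_le hε hα' f x y)
  have hfx : ∀ x, S (softmin C ε α f x) = f x := fun x => DFunLike.congr_fun hf x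
  refine ⟨f, ⟨fun x => H (softmin C ε α f x), hH.comp (continuous_softmin hε hα' f)⟩,
    fun x => ?_⟩
  rw [kernelPotential_gibbsMeasure, ← exp_neg_softmin hε hα']
  have := hSH (softmin C ε α f x)
  rw [hfx x] at this
  exact this

end Potential

/-! ### Duality -/

section Duality

variable {X : Type*} [MetricSpace X] [CompactSpace X] [MeasurableSpace X] [BorelSpace X]
  {C : C(X × X, ℝ)}

/-- The kernel `exp ((f ⊕ f - C) / ε)`. -/
def scaledKernel (C : C(X × X, ℝ)) (ε : ℝ) (f : C(X, ℝ)) : C(X × X, ℝ) :=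
  ⟨fun z => Real.exp ((f z.1 + f z.2 - C z) / ε), by fun_prop⟩

theorem scaledKernel_apply (f : C(X, ℝ)) (x y : X) :
    scaledKernel C ε f (x, y) =
      Real.exp (f x / ε) * (Real.exp (f y / ε) * gibbsKernel C ε (x, y)) := by
  change Real.exp _ = Real.exp _ * (Real.exp _ * Real.exp _)
  rw [← Real.exp_add, ← Real.exp_add, ← add_div, ← add_div]
  congr 2
  ring

theorem kernelPotential_scaledKernel (f : C(X, ℝ)) (α : FiniteMeasure X) (x : X) :
    kernelPotential (scaledKernel C ε f) (α : Measure X) x = Real.exp (f x / ε) *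
      kernelPotential (gibbsKernel C ε) (gibbsMeasure ε f α : Measure X) x := by
  rw [kernelPotential_apply, kernelPotential_apply, integral_gibbsMeasure, ← integral_const_mul]
  simp only [scaledKernel_apply]

theorem energy_gibbsMeasure (f : C(X, ℝ)) (α : FiniteMeasure X) :
    energy (gibbsKernel C ε) (gibbsMeasure ε f α : Measure X) (gibbsMeasure ε f α : Measure X) =
      energy (scaledKernel C ε f) (α : Measure X) (α : Measure X) := by
  rw [energy_eq_integral_kernelPotential, energy_eq_integral_kernelPotential,
    integral_gibbsMeasure]
  simp only [kernelPotential_scaledKernel]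

theorem logDensity_gibbsMeasure (hε : 0 < ε) (f : C(X, ℝ)) (α : FiniteMeasure X) :
    ∀ᵐ x ∂(α : Measure X), logDensity ε α (gibbsMeasure ε f α) x = ((f x : ℝ) : EReal) := by
  have h := Measure.rnDeriv_withDensity (α : Measure X)
    (f := fun x => ENNReal.ofReal (Real.exp (f x / ε))) (by fun_prop)
  filter_upwards [h] with x hx
  rw [logDensity, coe_gibbsMeasure, hx, ENNReal.log_ofReal_of_pos (Real.exp_pos _), Real.log_exp,
    ← EReal.coe_mul, mul_div_cancel₀ _ hε.ne']

theorem dualFunctional_eq_neg_primalFunctional (hε : 0 < ε) (α : FiniteMeasure X) (f : C(X, ℝ)) :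
    dualFunctional φ C ε α f = -primalFunctional φ C ε α (gibbsMeasure ε f α) := by
  have h1 : erealIntegral (α : Measure X)
      (fun x => conj φ (-logDensity ε α (gibbsMeasure ε f α) x)) =
      erealIntegral (α : Measure X) (fun x => conj φ (-((f x : ℝ) : EReal))) :=
    erealIntegral_congr_ae
      ((logDensity_gibbsMeasure hε f α).mono fun x hx => by simp only [hx])
  have h2 : ∫ z : X × X, Real.exp ((f z.1 + f z.2 - C z) / ε)
      ∂((α : Measure X).prod (α : Measure X)) =
      energy (gibbsKernel C ε) (gibbsMeasure ε f α : Measure X)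
        (gibbsMeasure ε f α : Measure X) := by
    rw [energy_gibbsMeasure, energy_eq_integral_prod]
    rfl
  unfold dualFunctional primalFunctional
  rw [h1, h2, EReal.neg_add (.inr (EReal.coe_ne_top _)) (.inr (EReal.coe_ne_bot _))]
  rfl

theorem sinkhornEntropy_eq_iInf (hε : 0 < ε) (α : FiniteMeasure X) :
    sinkhornEntropy φ C ε α =
      ⨅ f : C(X, ℝ), primalFunctional φ C ε α (gibbsMeasure ε f α) := by
  unfold sinkhornEntropy
  simp only [dualFunctional_eq_neg_primalFunctional hε]
  refine le_antisymm (le_iInf fun f => ?_) ?_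
  · rw [EReal.neg_le]
    exact le_iSup (fun f => -primalFunctional φ C ε α (gibbsMeasure ε f α)) f
  · rw [EReal.le_neg]
    exact iSup_le fun f => EReal.neg_le_neg_iff.2 (iInf_le _ f)

theorem primalFunctional_gibbsMeasure (hε : 0 < ε) (α : FiniteMeasure X) {f h : C(X, ℝ)}
    (hf : ∀ x, conj φ (-((f x : ℝ) : EReal)) = ((h x : ℝ) : EReal)) :
    primalFunctional φ C ε α (gibbsMeasure ε f α) =
      ((∫ x, h x ∂(α : Measure X) +
        ε / 2 * energy (scaledKernel C ε f) (α : Measure X) (α : Measure X) : ℝ) : EReal) := by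
  rw [EReal.coe_add, ← energy_gibbsMeasure,
    ← erealIntegral_coe (integrable_of_continuous (map_continuous h) _)]
  unfold primalFunctional
  rw [erealIntegral_congr_ae (g' := fun x => ((h x : ℝ) : EReal))]
  · rfl
  · filter_upwards [logDensity_gibbsMeasure hε f α] with x hx
    rw [hx, hf]

theorem kernelPotential_gibbsKernel_nonneg (μ : Measure X) [IsFiniteMeasure μ] (x : X) :
    0 ≤ kernelPotential (gibbsKernel C ε) μ x :=
  integral_nonneg fun _ => (Real.exp_pos _).le

theorem integral_rnDeriv_mul_le {c : X → ℝ} (hc : Continuous c) (hc0 : ∀ x, 0 ≤ c x)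
    (μ β : Measure X) [IsFiniteMeasure μ] [IsFiniteMeasure β] :
    ∫ x, (μ.rnDeriv β x).toReal * c x ∂β ≤ ∫ x, c x ∂μ := by
  have h := integral_withDensity_eq_integral_toReal_smul (Measure.measurable_rnDeriv μ β)
    (Measure.rnDeriv_lt_top μ β) c
  simp only [smul_eq_mul] at h
  rw [← h]
  exact integral_mono_measure (Measure.withDensity_rnDeriv_le μ β) (.of_forall hc0)
    (integrable_of_continuous hc μ)

/-- The scalar inequality at `u = ε log (dμ/dβ)`, where `exp (u / ε)` is the density itself. Where
the density vanishes, the right side is `φ*(+∞) = +∞`. -/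
theorem conj_neg_logDensity_ge (hφ : φ 1 = 0) (hε : 0 < ε) {β μ : FiniteMeasure X} {x : X}
    {p c : ℝ} (hr : (μ : Measure X).rnDeriv (β : Measure X) x < ⊤)
    (hp : ∀ u v : ℝ, conj φ (-(u : EReal)) ≤ (v : EReal) → p ≤ v + ε * c * Real.exp (u / ε)) :
    ((p - ε * (((μ : Measure X).rnDeriv (β : Measure X) x).toReal * c) : ℝ) : EReal) ≤
      conj φ (-logDensity ε β μ x) := by
  unfold logDensity
  set r := (μ : Measure X).rnDeriv (β : Measure X) x
  by_cases hr0 : r = 0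
  · rw [hr0, ENNReal.log_zero, EReal.coe_mul_bot_of_pos hε, EReal.neg_bot, conj_top hφ]
    exact le_top
  · have hrpos : 0 < r.toReal := ENNReal.toReal_pos hr0 hr.ne
    rw [ENNReal.log_pos_real hr0 hr.ne, ← EReal.coe_mul]
    by_cases htop : conj φ (-((ε * Real.log r.toReal : ℝ) : EReal)) = ⊤
    · rw [htop]
      exact le_top
    · have hv := EReal.coe_toReal htop (conj_neg_ne_bot hφ _)
      have h := hp _ _ hv.symm.le
      rw [mul_div_cancel_left₀ _ hε.ne', Real.exp_log hrpos] at h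
      rw [← hv, EReal.coe_le_coe_iff]
      linarith

/-- Weak duality, with the remainder given by the kernel distance. -/
theorem le_primalFunctional (hφ : φ 1 = 0) (hε : 0 < ε) {β μ μ₀ : FiniteMeasure X}
    {p : C(X, ℝ)} (hp : ∀ᵐ x ∂(β : Measure X), ∀ u v : ℝ, conj φ (-(u : EReal)) ≤ (v : EReal) →
      p x ≤ v + ε * kernelPotential (gibbsKernel C ε) (μ₀ : Measure X) x * Real.exp (u / ε)) :
    ((∫ x, p x ∂(β : Measure X) -
        ε / 2 * energy (gibbsKernel C ε) (μ₀ : Measure X) (μ₀ : Measure X) +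
        ε / 2 * energyDist (gibbsKernel C ε) (μ : Measure X) (μ₀ : Measure X) : ℝ) : EReal) ≤
      primalFunctional φ C ε β μ := by
  set c := kernelPotential (gibbsKernel C ε) (μ₀ : Measure X) with hc
  have hint : Integrable (fun x =>
      ((μ : Measure X).rnDeriv (β : Measure X) x).toReal * c x) (β : Measure X) :=
    Measure.integrable_toReal_rnDeriv.mul_bdd (c := ‖c‖)
      (map_continuous c).aestronglyMeasurable (.of_forall c.norm_coe_le_norm)
  have hpint := integrable_of_continuous (map_continuous p) (β : Measure X)
  have h1 : ((∫ x, p x ∂(β : Measure X) - ε * energy (gibbsKernel C ε) (μ : Measure X)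
      (μ₀ : Measure X) : ℝ) : EReal) ≤
      erealIntegral (β : Measure X) (fun x => conj φ (-logDensity ε β μ x)) := by
    refine le_trans ?_ (erealIntegral_mono (g := fun x => ((p x - ε *
      (((μ : Measure X).rnDeriv (β : Measure X) x).toReal * c x) : ℝ) : EReal)) ?_)
    · rw [erealIntegral_coe (h := fun x => p x - ε *
        (((μ : Measure X).rnDeriv (β : Measure X) x).toReal * c x)) (hpint.sub (hint.const_mul ε)), EReal.coe_le_coe_iff,
        integral_sub hpint (hint.const_mul ε), integral_const_mul]
      -- Only the absolutely continuous part of `μ` enters the entropy term; since `c ≥ 0`,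
      -- restoring the singular part only lowers the bound.
      have := integral_rnDeriv_mul_le (map_continuous c)
        (kernelPotential_gibbsKernel_nonneg _) (μ : Measure X) (β : Measure X)
      rw [energy_eq_integral_kernelPotential]
      linarith [mul_le_mul_of_nonneg_left this hε.le]
    · filter_upwards [hp, Measure.rnDeriv_lt_top (μ : Measure X) (β : Measure X)] with x hx hr
      exact conj_neg_logDensity_ge hφ hε hr hx
  unfold primalFunctional
  refine le_trans (le_of_eq ?_) (add_le_add_left h1 _)
  change _ = _ + ((ε / 2 * energy (gibbsKernel C ε) (μ : Measure X) (μ : Measure X) : ℝ) : EReal)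
  rw [← EReal.coe_add, EReal.coe_eq_coe_iff, energyDist]
  ring

/-- `f` is a continuous solution of the Sinkhorn equation for `α`, and `p` the associated
first variation `φ*(-f) + ε exp (f / ε) (k ⋆ μ)`, where `μ = exp (f / ε) α`. -/
structure IsSinkhornPotential (φ : ℝ≥0 → ℝ≥0∞) (C : C(X × X, ℝ)) (ε : ℝ) (α : FiniteMeasure X)
    (f p : C(X, ℝ)) : Prop where
  conj_eq : ∀ x, conj φ (-((f x : ℝ) : EReal)) =
    ((p x - ε * (kernelPotential (scaledKernel C ε f) (α : Measure X) x) : ℝ) : EReal)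
  le : α ≠ 0 → ∀ x, ∀ u v : ℝ, conj φ (-(u : EReal)) ≤ (v : EReal) →
    p x ≤ v + ε * kernelPotential (gibbsKernel C ε) (gibbsMeasure ε f α : Measure X) x *
      Real.exp (u / ε)

theorem exists_isSinkhornPotential (hφ : φ 1 = 0) (hε : 0 < ε) (α : FiniteMeasure X) :
    ∃ f p, IsSinkhornPotential φ C ε α f p := by
  by_cases hα : α = 0
  -- At `α = 0` the potential `k ⋆ μ` vanishes and the scalar problem may have no minimum, so the
  -- pointwise bound is required only for `α ≠ 0`.
  · refine ⟨0, 0, fun x => ?_, fun h => absurd hα h⟩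
    simp [hα, conj_zero hφ, kernelPotential_apply]
  · obtain ⟨f, h, hfh⟩ := exists_potential (C := C) hφ hε hα
    refine ⟨f, h + ε • kernelPotential (scaledKernel C ε f) (α : Measure X), fun x => ?_,
      fun _ x u v huv => ?_⟩
    · rw [(hfh x).eq]
      simp
    · have h1 := (hfh x).le u v huv
      simp only [ContinuousMap.add_apply, ContinuousMap.smul_apply, smul_eq_mul,
        kernelPotential_scaledKernel]
      linarith

namespace IsSinkhornPotential

variable {α β : FiniteMeasure X} {f p : C(X, ℝ)}

theorem ae_le (H : IsSinkhornPotential φ C ε α f p) :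
    ∀ᵐ x ∂(α : Measure X), ∀ u v : ℝ, conj φ (-(u : EReal)) ≤ (v : EReal) →
      p x ≤ v + ε * kernelPotential (gibbsKernel C ε) (gibbsMeasure ε f α : Measure X) x *
        Real.exp (u / ε) := by
  by_cases hα : α = 0
  · subst hα
    exact ae_zero (α := X) ▸ Filter.eventually_bot
  · exact .of_forall (H.le hα)

/-- The potential of `α` is tested on an arbitrary `β`: the value is linear plus quadratic in `β`,
which is the source of the upper bound on `F_ε`. -/
theorem primalFunctional_gibbsMeasure_eq (H : IsSinkhornPotential φ C ε α f p) (hε : 0 < ε)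
    (β : FiniteMeasure X) :
    primalFunctional φ C ε β (gibbsMeasure ε f β) = ((∫ x, p x ∂(β : Measure X) -
      ε * energy (scaledKernel C ε f) (β : Measure X) (α : Measure X) +
      ε / 2 * energy (scaledKernel C ε f) (β : Measure X) (β : Measure X) : ℝ) : EReal) := by
  rw [primalFunctional_gibbsMeasure hε β
    (h := p - ε • kernelPotential (scaledKernel C ε f) (α : Measure X)) (fun x => H.conj_eq x)]
  congr 2
  simp only [ContinuousMap.sub_apply, ContinuousMap.smul_apply, smul_eq_mul]
  rw [integral_sub (integrable_of_continuous (map_continuous _) _)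
    ((integrable_of_continuous (map_continuous _) _).const_mul _), integral_const_mul,
    energy_eq_integral_kernelPotential]

theorem primalFunctional_eq (H : IsSinkhornPotential φ C ε α f p) (hε : 0 < ε) :
    primalFunctional φ C ε α (gibbsMeasure ε f α) = ((∫ x, p x ∂(α : Measure X) - ε / 2 *
      energy (gibbsKernel C ε) (gibbsMeasure ε f α : Measure X)
        (gibbsMeasure ε f α : Measure X) : ℝ) : EReal) := by
  rw [H.primalFunctional_gibbsMeasure_eq hε, energy_gibbsMeasure]
  congr 1
  ring

theorem primalFunctional_add_le (H : IsSinkhornPotential φ C ε α f p) (hφ : φ 1 = 0)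
    (hε : 0 < ε) (μ : FiniteMeasure X) :
    primalFunctional φ C ε α (gibbsMeasure ε f α) + ((ε / 2 * energyDist (gibbsKernel C ε)
      (μ : Measure X) (gibbsMeasure ε f α : Measure X) : ℝ) : EReal) ≤
      primalFunctional φ C ε α μ := by
  rw [H.primalFunctional_eq hε, ← EReal.coe_add]
  exact le_primalFunctional hφ hε H.ae_le

theorem primalFunctional_le (H : IsSinkhornPotential φ C ε α f p) (hφ : φ 1 = 0)
    (hε : 0 < ε) (hC : ∀ x y, C (x, y) = C (y, x)) (hpos : IsPositiveKernel (gibbsKernel C ε))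
    (μ : FiniteMeasure X) :
    primalFunctional φ C ε α (gibbsMeasure ε f α) ≤ primalFunctional φ C ε α μ := by
  refine le_trans ?_ (H.primalFunctional_add_le hφ hε μ)
  refine le_add_of_nonneg_right (EReal.coe_nonneg.2 (mul_nonneg (by positivity) ?_))
  exact energyDist_nonneg (fun x y => by simp [gibbsKernel, hC x y]) hpos

theorem eq_gibbsMeasure (H : IsSinkhornPotential φ C ε α f p) (hφ : φ 1 = 0)
    (hε : 0 < ε) (hC : ∀ x y, C (x, y) = C (y, x)) (hpos : IsPositiveKernel (gibbsKernel C ε))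
    (huniv : IsUniversalKernel (gibbsKernel C ε)) {μ : FiniteMeasure X}
    (hμ : primalFunctional φ C ε α (gibbsMeasure ε f α) = primalFunctional φ C ε α μ) :
    μ = gibbsMeasure ε f α := by
  have hk : ∀ x y, gibbsKernel C ε (x, y) = gibbsKernel C ε (y, x) :=
    fun x y => by simp [gibbsKernel, hC x y]
  have h := H.primalFunctional_add_le hφ hε μ
  rw [← hμ, H.primalFunctional_eq hε, ← EReal.coe_add, EReal.coe_le_coe_iff] at h
  refine eq_of_energyDist_eq_zero hk hpos huniv (le_antisymm ?_ (energyDist_nonneg hk hpos))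
  by_contra! hlt
  have : 0 < ε / 2 * energyDist (gibbsKernel C ε) (μ : Measure X)
    (gibbsMeasure ε f α : Measure X) := by positivity
  linarith

theorem sinkhornEntropy_eq (H : IsSinkhornPotential φ C ε α f p) (hφ : φ 1 = 0)
    (hε : 0 < ε) (hC : ∀ x y, C (x, y) = C (y, x)) (hpos : IsPositiveKernel (gibbsKernel C ε)) :
    sinkhornEntropy φ C ε α = primalFunctional φ C ε α (gibbsMeasure ε f α) := by
  rw [sinkhornEntropy_eq_iInf hε]
  exact le_antisymm (iInf_le _ f) (le_iInf fun g => H.primalFunctional_le hφ hε hC hpos _)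

end IsSinkhornPotential

end Duality

/-! ### Supporting hyperplanes -/

section Support

variable {X : Type*} [MetricSpace X] [CompactSpace X] [MeasurableSpace X] [BorelSpace X]
  {C : C(X × X, ℝ)}

theorem gibbsMeasure_neg_gibbsMeasure (f : C(X, ℝ)) (α : FiniteMeasure X) :
    gibbsMeasure ε (-f) (gibbsMeasure ε f α) = α := by
  refine FiniteMeasure.ext_of_forall_integral_eq fun g => ?_
  rw [integral_gibbsMeasure, integral_gibbsMeasure]
  refine integral_congr_ae (.of_forall fun x => ?_)
  change Real.exp (f x / ε) * (Real.exp (-f x / ε) * g x) = g x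
  rw [← mul_assoc, ← Real.exp_add, neg_div, add_neg_cancel, Real.exp_zero, one_mul]

theorem gibbsMeasure_zero (f : C(X, ℝ)) : gibbsMeasure ε f (0 : FiniteMeasure X) = 0 :=
  Subtype.ext (withDensity_zero_left _)

theorem gibbsMeasure_eq_zero_iff {f : C(X, ℝ)} {α : FiniteMeasure X} :
    gibbsMeasure ε f α = 0 ↔ α = 0 := by
  refine ⟨fun h => ?_, fun h => by rw [h, gibbsMeasure_zero]⟩
  rw [← gibbsMeasure_neg_gibbsMeasure (ε := ε) f α, h, gibbsMeasure_zero]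

theorem IsScalarMin.unique (hε : 0 < ε) {c s s' h h' : ℝ} (hc : 0 < c)
    (H : IsScalarMin φ ε c s h) (H' : IsScalarMin φ ε c s' h') : s = s' := by
  have key : ∀ {s s' h h' : ℝ}, IsScalarMin φ ε c s h → IsScalarMin φ ε c s' h' → s' ≤ s := by
    intro s s' h h' H H'
    have hexp : Real.exp (-(-(ε * Real.log c)) / ε) = c := by
      rw [neg_neg, mul_div_cancel_left₀ _ hε.ne', Real.exp_log hc]
    rw [← hexp] at H H'
    by_contra! hlt
    have := H.le_add_of_le hε H' hlt
    linarith
  exact le_antisymm (key H' H) (key H H')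

namespace IsSinkhornPotential

variable {α β : FiniteMeasure X} {f p g q : C(X, ℝ)}

theorem isScalarMin (H : IsSinkhornPotential φ C ε α f p) (hα : α ≠ 0) (x : X) :
    IsScalarMin φ ε
      (kernelPotential (gibbsKernel C ε) (gibbsMeasure ε f α : Measure X) x) (f x)
      (p x - ε * (kernelPotential (scaledKernel C ε f) (α : Measure X) x)) := by
  refine ⟨H.conj_eq x, fun u v huv => ?_⟩
  have := H.le hα x u v huv
  rw [kernelPotential_scaledKernel]
  linarith

/-- The optimal measure `μ` determines `k ⋆ μ`, hence the potential by uniqueness of the scalar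
minimiser, hence `α = exp (-f / ε) μ`. This makes the subgradient inequality strict. -/
theorem eq_of_gibbsMeasure_eq (H : IsSinkhornPotential φ C ε α f p)
    (H' : IsSinkhornPotential φ C ε β g q) (hε : 0 < ε) (hα : α ≠ 0)
    (h : gibbsMeasure ε g β = gibbsMeasure ε f α) : β = α := by
  have hβ : β ≠ 0 := fun h0 => hα (by
    rw [h0, gibbsMeasure_zero] at h
    exact gibbsMeasure_eq_zero_iff.1 h.symm)
  have hfg : g = f := by
    ext x
    have h1 := H.isScalarMin hα x
    have h2 := H'.isScalarMin hβ x
    have hc : 0 < kernelPotential (gibbsKernel C ε) (gibbsMeasure ε f α : Measure X) x := by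
      rw [kernelPotential_gibbsMeasure]
      have hα' : (α : Measure X) ≠ 0 := fun h => hα (Subtype.ext h)
      exact integral_exp_pos_of_ne_zero hα' f x
    rw [h] at h2
    exact h2.unique hε hc h1
  rw [← gibbsMeasure_neg_gibbsMeasure (ε := ε) f α, ← h, hfg, gibbsMeasure_neg_gibbsMeasure]

theorem add_le_toReal (H : IsSinkhornPotential φ C ε α f p)
    (H' : IsSinkhornPotential φ C ε β g q) (hφ : φ 1 = 0)
    (hε : 0 < ε) (hC : ∀ x y, C (x, y) = C (y, x)) (hpos : IsPositiveKernel (gibbsKernel C ε))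
    (hα : α ≠ 0) :
    (sinkhornEntropy φ C ε α).toReal + (∫ x, p x ∂(β : Measure X) - ∫ x, p x ∂(α : Measure X)) +
      ε / 2 * energyDist (gibbsKernel C ε) (gibbsMeasure ε g β : Measure X)
        (gibbsMeasure ε f α : Measure X) ≤ (sinkhornEntropy φ C ε β).toReal := by
  have h := le_primalFunctional (C := C) (β := β) (μ := gibbsMeasure ε g β)
    (μ₀ := gibbsMeasure ε f α) hφ hε (.of_forall (H.le hα))
  rw [H'.primalFunctional_eq hε, EReal.coe_le_coe_iff] at h
  rw [H.sinkhornEntropy_eq hφ hε hC hpos, H'.sinkhornEntropy_eq hφ hε hC hpos,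
    H.primalFunctional_eq hε, H'.primalFunctional_eq hε, EReal.toReal_coe, EReal.toReal_coe]
  linarith

theorem toReal_le (H : IsSinkhornPotential φ C ε α f p) (hφ : φ 1 = 0)
    (hε : 0 < ε) (hC : ∀ x y, C (x, y) = C (y, x)) (hpos : IsPositiveKernel (gibbsKernel C ε))
    (β : FiniteMeasure X) :
    (sinkhornEntropy φ C ε β).toReal ≤ (sinkhornEntropy φ C ε α).toReal +
      (∫ x, p x ∂(β : Measure X) - ∫ x, p x ∂(α : Measure X)) +
      ε / 2 * energyDist (scaledKernel C ε f) (β : Measure X) (α : Measure X) := by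
  obtain ⟨g, q, H'⟩ := exists_isSinkhornPotential (C := C) hφ hε β
  have h := H'.primalFunctional_le hφ hε hC hpos (gibbsMeasure ε f β)
  rw [H.primalFunctional_gibbsMeasure_eq hε, H'.primalFunctional_eq hε,
    EReal.coe_le_coe_iff] at h
  rw [H.sinkhornEntropy_eq hφ hε hC hpos, H'.sinkhornEntropy_eq hφ hε hC hpos,
    H.primalFunctional_eq hε, H'.primalFunctional_eq hε, EReal.toReal_coe, EReal.toReal_coe,
    energyDist]
  rw [energy_gibbsMeasure (α := α)]
  linarith

end IsSinkhornPotential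

theorem exists_isSinkhornPotential_forall_add_le (hφ : φ 1 = 0) (hε : 0 < ε)
    (hC : ∀ x y, C (x, y) = C (y, x)) (hpos : IsPositiveKernel (gibbsKernel C ε))
    (huniv : IsUniversalKernel (gibbsKernel C ε)) {α : FiniteMeasure X} (hα : α ≠ 0) :
    ∃ f p, IsSinkhornPotential φ C ε α f p ∧
      (∀ β : FiniteMeasure X, (sinkhornEntropy φ C ε α).toReal +
        (∫ x, p x ∂(β : Measure X) - ∫ x, p x ∂(α : Measure X)) ≤
          (sinkhornEntropy φ C ε β).toReal) ∧
      (∀ β : FiniteMeasure X, β ≠ α → (sinkhornEntropy φ C ε α).toReal +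
        (∫ x, p x ∂(β : Measure X) - ∫ x, p x ∂(α : Measure X)) <
          (sinkhornEntropy φ C ε β).toReal) := by
  obtain ⟨f, p, H⟩ := exists_isSinkhornPotential (C := C) hφ hε α
  have hk : ∀ x y, gibbsKernel C ε (x, y) = gibbsKernel C ε (y, x) :=
    fun x y => by simp [gibbsKernel, hC x y]
  refine ⟨f, p, H, fun β => ?_, fun β hβα => ?_⟩
  · obtain ⟨g, q, H'⟩ := exists_isSinkhornPotential (C := C) hφ hε β
    have h := H.add_le_toReal H' hφ hε hC hpos hα
    have h2 : 0 ≤ energyDist (gibbsKernel C ε) (gibbsMeasure ε g β : Measure X)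
        (gibbsMeasure ε f α : Measure X) := energyDist_nonneg hk hpos
    have h3 : 0 ≤ ε / 2 * energyDist (gibbsKernel C ε) (gibbsMeasure ε g β : Measure X)
        (gibbsMeasure ε f α : Measure X) := by positivity
    linarith
  · obtain ⟨g, q, H'⟩ := exists_isSinkhornPotential (C := C) hφ hε β
    have h := H.add_le_toReal H' hφ hε hC hpos hα
    have h2 : 0 < energyDist (gibbsKernel C ε) (gibbsMeasure ε g β : Measure X)
        (gibbsMeasure ε f α : Measure X) := by
      refine lt_of_le_of_ne (energyDist_nonneg hk hpos) fun h0 => hβα ?_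
      exact H.eq_of_gibbsMeasure_eq H' hε hα (eq_of_energyDist_eq_zero hk hpos huniv h0.symm)
    have h3 : 0 < ε / 2 * energyDist (gibbsKernel C ε) (gibbsMeasure ε g β : Measure X)
        (gibbsMeasure ε f α : Measure X) := by positivity
    linarith

theorem sinkhornEntropy_ne_bot_and_ne_top (hφ : φ 1 = 0) (hε : 0 < ε)
    (hC : ∀ x y, C (x, y) = C (y, x)) (hpos : IsPositiveKernel (gibbsKernel C ε))
    (α : FiniteMeasure X) :
    sinkhornEntropy φ C ε α ≠ ⊥ ∧ sinkhornEntropy φ C ε α ≠ ⊤ := by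
  obtain ⟨f, p, H⟩ := exists_isSinkhornPotential (C := C) hφ hε α
  rw [H.sinkhornEntropy_eq hφ hε hC hpos, H.primalFunctional_eq hε]
  exact ⟨EReal.coe_ne_bot _, EReal.coe_ne_top _⟩

theorem integral_add_smul (p : C(X, ℝ)) (α β : FiniteMeasure X) (a b : ℝ≥0) :
    ∫ x, p x ∂((a • α + b • β : FiniteMeasure X) : Measure X) =
      a * ∫ x, p x ∂(α : Measure X) + b * ∫ x, p x ∂(β : Measure X) := by
  rw [FiniteMeasure.toMeasure_add, FiniteMeasure.toMeasure_smul, FiniteMeasure.toMeasure_smul,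
    integral_add_measure (integrable_of_continuous (map_continuous _) _)
      (integrable_of_continuous (map_continuous _) _)]
  simp [NNReal.smul_def]

theorem strictConvexOn_sinkhornEntropy (hφ : φ 1 = 0) (hε : 0 < ε)
    (hC : ∀ x y, C (x, y) = C (y, x)) (hpos : IsPositiveKernel (gibbsKernel C ε))
    (huniv : IsUniversalKernel (gibbsKernel C ε)) :
    StrictConvexOn ℝ≥0 Set.univ
      (fun α : FiniteMeasure X => (sinkhornEntropy φ C ε α).toReal) := by
  refine ⟨convex_univ, fun α _ β _ hαβ a b ha hb hab => ?_⟩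
  set γ := a • α + b • β with hγ
  -- Both weights are positive, so `γ = 0` would force `α = β = 0`. A strict supporting hyperplane
  -- is therefore available at `γ`.
  have hγ0 : γ ≠ 0 := by
    intro h0
    have h1 : a * α.mass + b * β.mass = 0 := by
      have := congrArg FiniteMeasure.mass h0
      simpa [hγ, FiniteMeasure.mass] using this
    rw [add_eq_zero, mul_eq_zero, mul_eq_zero, FiniteMeasure.mass_zero_iff,
      FiniteMeasure.mass_zero_iff] at h1
    exact hαβ ((h1.1.resolve_left ha.ne').trans (h1.2.resolve_left hb.ne').symm)
  obtain ⟨f, p, -, hle, hlt⟩ :=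
    exists_isSinkhornPotential_forall_add_le (φ := φ) hφ hε hC hpos huniv hγ0
  have hint : ∫ x, p x ∂(γ : Measure X) = _ := integral_add_smul p α β a b
  have ha' : (0 : ℝ) < a := ha
  have hb' : (0 : ℝ) < b := hb
  have hab' : (a : ℝ) + b = 1 := by exact_mod_cast hab
  change (sinkhornEntropy φ C ε γ).toReal < (a : ℝ) * (sinkhornEntropy φ C ε α).toReal +
    (b : ℝ) * (sinkhornEntropy φ C ε β).toReal
  have hFγ : (sinkhornEntropy φ C ε γ).toReal = a * (sinkhornEntropy φ C ε γ).toReal +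
    b * (sinkhornEntropy φ C ε γ).toReal := by rw [← add_mul, hab', one_mul]
  have hIγ : ∫ x, p x ∂(γ : Measure X) = a * ∫ x, p x ∂(γ : Measure X) +
    b * ∫ x, p x ∂(γ : Measure X) := by rw [← add_mul, hab', one_mul]
  have h1 := mul_le_mul_of_nonneg_left (hle α) ha'.le
  have h2 := mul_le_mul_of_nonneg_left (hle β) hb'.le
  by_cases hα : α = γ
  · have h3 := mul_lt_mul_of_pos_left (hlt β fun h => hαβ (hα.trans h.symm)) hb'
    linarith
  · have h3 := mul_lt_mul_of_pos_left (hlt α hα) ha'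
    linarith

end Support

/-! ### Weak* continuity -/

section WeakContinuity

variable {X : Type*} [MetricSpace X] [CompactSpace X] [MeasurableSpace X] [BorelSpace X]
  {C : C(X × X, ℝ)}

theorem tendsto_integral_of_tendsto {α : FiniteMeasure X} (g : C(X, ℝ)) :
    Tendsto (fun β : FiniteMeasure X => ∫ x, g x ∂(β : Measure X)) (𝓝 α)
      (𝓝 (∫ x, g x ∂(α : Measure X))) :=
  FiniteMeasure.tendsto_iff_forall_integral_tendsto.1 tendsto_id
    (BoundedContinuousFunction.mkOfCompact g)

theorem abs_energy_self_le (k : C(X × X, ℝ)) (β : FiniteMeasure X) :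
    |energy k (β : Measure X) (β : Measure X)| ≤ ‖k‖ * (β.mass : ℝ) ^ 2 := by
  rw [energy_eq_integral_prod]
  refine (norm_integral_le_of_norm_le_const (.of_forall k.norm_coe_le_norm)).trans (le_of_eq ?_)
  rw [← Set.univ_prod_univ, measureReal_prod_prod, sq]
  rfl

theorem tendsto_energy_self_zero (k : C(X × X, ℝ)) :
    Tendsto (fun β : FiniteMeasure X => energy k (β : Measure X) (β : Measure X))
      (𝓝 0) (𝓝 0) := by
  refine squeeze_zero_norm (abs_energy_self_le k) ?_
  have h : Continuous fun β : FiniteMeasure X => ‖k‖ * (β.mass : ℝ) ^ 2 :=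
    continuous_const.mul ((NNReal.continuous_coe.comp FiniteMeasure.continuous_mass).pow 2)
  simpa using h.tendsto 0

/-- Normalisation, continuous away from zero, reduces the claim to weak continuity of products of
probability measures. -/
theorem tendsto_energy_self (k : C(X × X, ℝ)) {α : FiniteMeasure X} (hα : α ≠ 0) :
    Tendsto (fun β : FiniteMeasure X => energy k (β : Measure X) (β : Measure X))
      (𝓝 α) (𝓝 (energy k (α : Measure X) (α : Measure X))) := by
  have hne : Nonempty X := by
    by_contra h
    rw [not_nonempty_iff] at h
    exact hα (Subtype.ext (Measure.eq_zero_of_isEmpty _))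
  have hself : ∀ β : FiniteMeasure X, energy k (β : Measure X) (β : Measure X) =
      (β.mass : ℝ) ^ 2 *
        ∫ z, k z ∂((β.normalize.prod β.normalize : ProbabilityMeasure (X × X)) :
          Measure (X × X)) := by
    intro β
    have h : (β : Measure X) = β.mass • (β.normalize : Measure X) :=
      congrArg Subtype.val β.self_eq_mass_smul_normalize
    conv_lhs => rw [h]
    rw [energy_smul_left, energy_smul_right, energy_eq_integral_prod, ← mul_assoc, ← sq]
    rfl
  simp only [hself]
  refine Tendsto.mul ?_ ?_
  · exact (((NNReal.continuous_coe.comp FiniteMeasure.continuous_mass).pow 2).tendsto α)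
  · have h1 : Tendsto (fun β : FiniteMeasure X => β.normalize) (𝓝 α) (𝓝 α.normalize) :=
      FiniteMeasure.tendsto_normalize_of_tendsto tendsto_id hα
    have h2 := (ProbabilityMeasure.continuous_prod (α := X) (β := X)).tendsto
      (α.normalize, α.normalize)
    have h3 := h2.comp (h1.prodMk_nhds h1)
    exact ProbabilityMeasure.tendsto_iff_forall_integral_tendsto.1 h3
      (BoundedContinuousFunction.mkOfCompact k)

theorem continuousAt_sinkhornEntropy_of_ne_zero (hφ : φ 1 = 0) (hε : 0 < ε)
    (hC : ∀ x y, C (x, y) = C (y, x)) (hpos : IsPositiveKernel (gibbsKernel C ε))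
    (huniv : IsUniversalKernel (gibbsKernel C ε)) {α : FiniteMeasure X} (hα : α ≠ 0) :
    ContinuousAt (fun α : FiniteMeasure X => (sinkhornEntropy φ C ε α).toReal) α := by
  obtain ⟨f, p, H, hle, -⟩ :=
    exists_isSinkhornPotential_forall_add_le (φ := φ) hφ hε hC hpos huniv hα
  have h1 : Tendsto (fun β : FiniteMeasure X => (sinkhornEntropy φ C ε α).toReal +
      (∫ x, p x ∂(β : Measure X) - ∫ x, p x ∂(α : Measure X))) (𝓝 α)
      (𝓝 (sinkhornEntropy φ C ε α).toReal) := by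
    simpa using (tendsto_const_nhds (x := (sinkhornEntropy φ C ε α).toReal)).add
      ((tendsto_integral_of_tendsto (α := α) p).sub
        (tendsto_const_nhds (x := ∫ x, p x ∂(α : Measure X))))
  have h2 : Tendsto (fun β : FiniteMeasure X =>
      energyDist (scaledKernel C ε f) (β : Measure X) (α : Measure X)) (𝓝 α) (𝓝 0) := by
    have := ((tendsto_energy_self (scaledKernel C ε f) hα).sub
      ((tendsto_integral_of_tendsto (α := α)
        (kernelPotential (scaledKernel C ε f) (α : Measure X))).const_mul 2)).add
      (tendsto_const_nhds (x := energy (scaledKernel C ε f) (α : Measure X) (α : Measure X)))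
    rw [← energy_eq_integral_kernelPotential] at this
    have h0 : ∀ a : ℝ, a - 2 * a + a = 0 := fun a => by ring
    rw [h0] at this
    exact this
  refine tendsto_of_tendsto_of_tendsto_of_le_of_le h1 ?_ hle (H.toReal_le hφ hε hC hpos)
  simpa using h1.add (h2.const_mul (ε / 2))

theorem sinkhornEntropy_zero (hφ : φ 1 = 0) (hε : 0 < ε)
    (hC : ∀ x y, C (x, y) = C (y, x)) (hpos : IsPositiveKernel (gibbsKernel C ε)) :
    sinkhornEntropy φ C ε (0 : FiniteMeasure X) = 0 := by
  obtain ⟨f, p, H⟩ := exists_isSinkhornPotential (C := C) hφ hε (0 : FiniteMeasure X)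
  rw [H.sinkhornEntropy_eq hφ hε hC hpos, H.primalFunctional_eq hε, gibbsMeasure_zero]
  simp [energy]

/-- At zero no supporting hyperplane need exist. Weak duality against `η δ_y` still works: its
kernel potential is bounded below by a positive constant, so the scalar minimum is finite. The slope
`m` depends on `η`, but the constant is of order `η ^ 2`. -/
theorem exists_mul_mass_sub_le_toReal (hφ : φ 1 = 0) (hε : 0 < ε)
    (hC : ∀ x y, C (x, y) = C (y, x)) (hpos : IsPositiveKernel (gibbsKernel C ε)) (y : X)
    {η : ℝ≥0} (hη : 0 < η) :
    ∃ m : ℝ, ∀ β : FiniteMeasure X,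
      m * β.mass - ε / 2 * (η ^ 2 * gibbsKernel C ε (y, y)) ≤
        (sinkhornEntropy φ C ε β).toReal := by
  have hk : ∀ x y, gibbsKernel C ε (x, y) = gibbsKernel C ε (y, x) :=
    fun x y => by simp [gibbsKernel, hC x y]
  let μ₀ : FiniteMeasure X := η • ⟨Measure.dirac y, inferInstance⟩
  have hμ₀ : (μ₀ : Measure X) = η • Measure.dirac y := FiniteMeasure.toMeasure_smul _ _
  obtain ⟨x₀, -, hx₀⟩ := isCompact_univ.exists_isMinOn ⟨y, trivial⟩
    (f := fun x => gibbsKernel C ε (x, y)) (by fun_prop)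
  have hc : 0 < η * gibbsKernel C ε (x₀, y) := mul_pos hη (Real.exp_pos _)
  obtain ⟨s, h, hmin⟩ := exists_isScalarMin (φ := φ) hφ hε hc
  refine ⟨h + ε * (η * gibbsKernel C ε (x₀, y)) * Real.exp (s / ε), fun β => ?_⟩
  obtain ⟨g, q, H'⟩ := exists_isSinkhornPotential (C := C) hφ hε β
  have hpot : ∀ x, kernelPotential (gibbsKernel C ε) (μ₀ : Measure X) x =
      η * gibbsKernel C ε (x, y) := by
    intro x
    rw [kernelPotential_apply, hμ₀]
    simp [NNReal.smul_def]
  have hle := le_primalFunctional (C := C) (β := β) (μ := gibbsMeasure ε g β) (μ₀ := μ₀)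
    (p := ContinuousMap.const X (h + ε * (η * gibbsKernel C ε (x₀, y)) * Real.exp (s / ε)))
    hφ hε (.of_forall fun x u v huv => by
      refine (hmin.le u v huv).trans ?_
      rw [hpot]
      have h1 : gibbsKernel C ε (x₀, y) ≤ gibbsKernel C ε (x, y) := hx₀ (Set.mem_univ x)
      gcongr)
  have hdist : 0 ≤ ε / 2 * energyDist (gibbsKernel C ε) (gibbsMeasure ε g β : Measure X)
      (μ₀ : Measure X) := mul_nonneg (by positivity) (energyDist_nonneg hk hpos)
  have hen : energy (gibbsKernel C ε) (μ₀ : Measure X) (μ₀ : Measure X) =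
      η ^ 2 * gibbsKernel C ε (y, y) := by
    rw [hμ₀, energy_smul_left, energy_smul_right, energy_dirac_right]
    simp
    ring
  rw [H'.primalFunctional_eq hε, EReal.coe_le_coe_iff, hen] at hle
  simp only [ContinuousMap.const_apply, integral_const, smul_eq_mul] at hle
  rw [H'.sinkhornEntropy_eq hφ hε hC hpos, H'.primalFunctional_eq hε, EReal.toReal_coe]
  have hmass : (β : Measure X).real Set.univ = β.mass := rfl
  rw [hmass] at hle
  linarith

theorem continuousAt_sinkhornEntropy_zero (hφ : φ 1 = 0) (hε : 0 < ε)
    (hC : ∀ x y, C (x, y) = C (y, x)) (hpos : IsPositiveKernel (gibbsKernel C ε)) (y : X) :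
    ContinuousAt (fun α : FiniteMeasure X => (sinkhornEntropy φ C ε α).toReal) 0 := by
  have hup : ∀ β : FiniteMeasure X, (sinkhornEntropy φ C ε β).toReal ≤
      ε / 2 * energy (scaledKernel C ε 0) (β : Measure X) (β : Measure X) := by
    intro β
    obtain ⟨g, q, H'⟩ := exists_isSinkhornPotential (C := C) hφ hε β
    have h := H'.primalFunctional_le hφ hε hC hpos (gibbsMeasure ε 0 β)
    rw [primalFunctional_gibbsMeasure hε β (f := 0) (h := 0) (by simp [conj_zero hφ]),
      ← H'.sinkhornEntropy_eq hφ hε hC hpos] at h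
    have := EReal.toReal_le_toReal h
      (sinkhornEntropy_ne_bot_and_ne_top hφ hε hC hpos β).1 (EReal.coe_ne_top _)
    rw [EReal.toReal_coe] at this
    simpa using this
  unfold ContinuousAt
  beta_reduce
  rw [sinkhornEntropy_zero hφ hε hC hpos, EReal.toReal_zero, tendsto_order]
  constructor
  · intro a ha
    -- First `η` is fixed so that the constant exceeds `a`; only then does the mass of `β` tend to
    -- zero, absorbing `m`.
    obtain ⟨η, hη, hηa⟩ : ∃ η : ℝ≥0, 0 < η ∧
        a < -(ε / 2 * (η ^ 2 * gibbsKernel C ε (y, y))) := by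
      have hcont : Continuous fun η : ℝ≥0 =>
          -(ε / 2 * ((η : ℝ) ^ 2 * gibbsKernel C ε (y, y))) := by fun_prop
      have h1 : ∀ᶠ η : ℝ≥0 in 𝓝[>] 0,
          a < -(ε / 2 * ((η : ℝ) ^ 2 * gibbsKernel C ε (y, y))) :=
        (hcont.tendsto 0).eventually (lt_mem_nhds (by simpa using ha))
          |>.filter_mono nhdsWithin_le_nhds
      obtain ⟨η, hη1, hη2⟩ := (h1.and self_mem_nhdsWithin).exists
      exact ⟨η, hη2, hη1⟩
    obtain ⟨m, hm⟩ := exists_mul_mass_sub_le_toReal (φ := φ) hφ hε hC hpos y hη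
    have hcont : Continuous fun β : FiniteMeasure X =>
        m * (β.mass : ℝ) - ε / 2 * (η ^ 2 * gibbsKernel C ε (y, y)) :=
      (continuous_const.mul (NNReal.continuous_coe.comp FiniteMeasure.continuous_mass)).sub
        continuous_const
    have h1 : ∀ᶠ β in 𝓝 (0 : FiniteMeasure X),
        a < m * (β.mass : ℝ) - ε / 2 * (η ^ 2 * gibbsKernel C ε (y, y)) :=
      (hcont.tendsto 0).eventually (lt_mem_nhds (by simpa using hηa))
    exact h1.mono fun β hβ => hβ.trans_le (hm β)
  · intro a ha
    have h1 := (tendsto_energy_self_zero (scaledKernel C ε (0 : C(X, ℝ)))).const_mul (ε / 2)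
    rw [mul_zero] at h1
    exact (h1.eventually (gt_mem_nhds ha)).mono fun β hβ => (hup β).trans_lt hβ

theorem continuous_sinkhornEntropy (hφ : φ 1 = 0) (hε : 0 < ε)
    (hC : ∀ x y, C (x, y) = C (y, x)) (hpos : IsPositiveKernel (gibbsKernel C ε))
    (huniv : IsUniversalKernel (gibbsKernel C ε)) :
    Continuous (fun α : FiniteMeasure X => sinkhornEntropy φ C ε α) := by
  have hreal : Continuous fun α : FiniteMeasure X => (sinkhornEntropy φ C ε α).toReal := by
    rcases isEmpty_or_nonempty X with hX | ⟨⟨y⟩⟩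
    · have h0 : ∀ α : FiniteMeasure X, α = 0 := fun α =>
        Subtype.ext (Measure.eq_zero_of_isEmpty _)
      have : (fun α : FiniteMeasure X => (sinkhornEntropy φ C ε α).toReal) =
          fun _ => (sinkhornEntropy φ C ε (0 : FiniteMeasure X)).toReal := by
        funext α
        rw [h0 α]
      rw [this]
      exact continuous_const
    · refine continuous_iff_continuousAt.2 fun α => ?_
      by_cases hα : α = 0
      · rw [hα]
        exact continuousAt_sinkhornEntropy_zero hφ hε hC hpos y
      · exact continuousAt_sinkhornEntropy_of_ne_zero hφ hε hC hpos huniv hα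
  refine (continuous_coe_real_ereal.comp hreal).congr fun α => ?_
  have h := sinkhornEntropy_ne_bot_and_ne_top (φ := φ) hφ hε hC hpos α
  exact EReal.coe_toReal h.2 h.1

end WeakContinuity

/-! ### Gradients -/

section Gradient

variable {X : Type*} [MetricSpace X] [CompactSpace X] [MeasurableSpace X] [BorelSpace X]
  {C : C(X × X, ℝ)}

theorem energyDist_of_toSignedMeasure_eq {k : C(X × X, ℝ)} (hk : ∀ x y, k (x, y) = k (y, x))
    {α β μ ν : Measure X}
    [IsFiniteMeasure α] [IsFiniteMeasure β] [IsFiniteMeasure μ] [IsFiniteMeasure ν] {t : ℝ}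
    (h : β.toSignedMeasure =
      α.toSignedMeasure + t • (μ.toSignedMeasure - ν.toSignedMeasure)) :
    energyDist k β α = t ^ 2 * energyDist k μ ν := by
  have hleft : ∀ ρ : Measure X, [IsFiniteMeasure ρ] →
      energy k β ρ = energy k α ρ + t * (energy k μ ρ - energy k ν ρ) := by
    intro ρ _
    exact integral_of_toSignedMeasure_eq (map_continuous (kernelPotential k ρ)) h
  have h1 := hleft β
  have h2 := hleft α
  have h3 := hleft μ
  have h4 := hleft ν
  rw [energy_comm (μ := α) (ν := β) hk, energy_comm (μ := μ) (ν := β) hk,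
    energy_comm (μ := ν) (ν := β) hk] at h1
  rw [energy_comm (μ := μ) (ν := α) hk, energy_comm (μ := ν) (ν := α) hk] at h2
  rw [energy_comm (μ := ν) (ν := μ) hk] at h3
  unfold energyDist
  linear_combination h1 - h2 + t * (h3 - h4)

theorem IsSinkhornPotential.hasMeasureGradientAt {α : FiniteMeasure X} {f p : C(X, ℝ)}
    (H : IsSinkhornPotential φ C ε α f p) (hφ : φ 1 = 0) (hε : 0 < ε)
    (hC : ∀ x y, C (x, y) = C (y, x)) (hpos : IsPositiveKernel (gibbsKernel C ε))
    (hle : ∀ β : FiniteMeasure X, (sinkhornEntropy φ C ε α).toReal +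
        (∫ x, p x ∂(β : Measure X) - ∫ x, p x ∂(α : Measure X)) ≤
          (sinkhornEntropy φ C ε β).toReal) :
    HasMeasureGradientAt (fun γ => (sinkhornEntropy φ C ε γ).toReal) α p := by
  intro δ β
  obtain ⟨μ, ν, rfl⟩ := exists_eq_toSignedMeasure_sub δ
  have hk : ∀ x y, scaledKernel C ε f (x, y) = scaledKernel C ε f (y, x) :=
    fun x y => by simp [scaledKernel, hC x y, add_comm (f x)]
  set K := ε / 2 * energyDist (scaledKernel C ε f) (μ : Measure X) (ν : Measure X) with hK
  -- The remainder lies between `0` (subgradient) and a kernel distance of `α + t δ` to `α`, which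
  -- is exactly quadratic in `t`.
  have hO : (fun t : ℝ => (sinkhornEntropy φ C ε (β t)).toReal -
      (sinkhornEntropy φ C ε α).toReal - t * ∫ᵛ x, p x ∂<•((μ : Measure X).toSignedMeasure -
        (ν : Measure X).toSignedMeasure)) =O[𝓝[{t : ℝ | (β t : Measure X).toSignedMeasure =
        (α : Measure X).toSignedMeasure + t • ((μ : Measure X).toSignedMeasure -
        (ν : Measure X).toSignedMeasure)}] 0] fun t : ℝ => t ^ 2 := by
    refine Asymptotics.IsBigO.of_bound |K| ?_
    filter_upwards [self_mem_nhdsWithin] with t ht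
    have h1 := hle (β t)
    have h2 := H.toReal_le hφ hε hC hpos (β t)
    rw [energyDist_of_toSignedMeasure_eq hk ht] at h2
    rw [integral_of_toSignedMeasure_eq (map_continuous p) ht] at h1 h2
    rw [integral_signed_sub (map_continuous p), Real.norm_eq_abs, Real.norm_eq_abs,
      abs_of_nonneg (sq_nonneg t), abs_of_nonneg (by linarith)]
    have h3 : K * t ^ 2 ≤ |K| * t ^ 2 := mul_le_mul_of_nonneg_right (le_abs_self K) (sq_nonneg t)
    have h4 : ε / 2 * (t ^ 2 * energyDist (scaledKernel C ε f) (μ : Measure X) (ν : Measure X)) =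
      K * t ^ 2 := by rw [hK]; ring
    linarith
  refine hO.trans_isLittleO (Asymptotics.IsLittleO.mono ?_ nhdsWithin_le_nhds)
  simpa using Asymptotics.isLittleO_pow_id (𝕜 := ℝ) one_lt_two

theorem HasMeasureGradientAt.unique {F : FiniteMeasure X → ℝ} {α : FiniteMeasure X}
    {p q : C(X, ℝ)} (hp : HasMeasureGradientAt F α p) (hq : HasMeasureGradientAt F α q) :
    p = q := by
  ext x
  let d : FiniteMeasure X := ⟨Measure.dirac x, inferInstance⟩
  -- Adding mass at `x` is admissible for every `t > 0`, and this one-sided derivative reads off the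
  -- gradient at `x`.
  let β : ℝ → FiniteMeasure X := fun t => α + t.toNNReal • d
  have hsub : Set.Ioi (0 : ℝ) ⊆ {t : ℝ | (β t : Measure X).toSignedMeasure =
      (α : Measure X).toSignedMeasure + t • (d : Measure X).toSignedMeasure} := by
    intro t ht
    have ht' : ((t.toNNReal : ℝ≥0) : ℝ) = t := Real.coe_toNNReal _ (le_of_lt ht)
    have h1 : (β t : Measure X) = (α : Measure X) + t.toNNReal • (d : Measure X) := by
      rw [FiniteMeasure.toMeasure_add, FiniteMeasure.toMeasure_smul]
    have h2 : (β t : Measure X).toSignedMeasure =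
        ((α : Measure X) + t.toNNReal • (d : Measure X)).toSignedMeasure := by
      congr 1
    change (β t : Measure X).toSignedMeasure = _
    rw [h2, Measure.toSignedMeasure_add, Measure.toSignedMeasure_smul]
    conv_rhs => rw [← ht']
    rfl
  have h := ((hp (d : Measure X).toSignedMeasure β).sub
    (hq (d : Measure X).toSignedMeasure β)).mono (nhdsWithin_mono 0 hsub)
  have hdirac : ∀ g : C(X, ℝ), ∫ᵛ y, g y ∂<•((d : Measure X).toSignedMeasure) = g x := by
    intro g
    rw [VectorMeasure.integral_toSignedMeasure]
    exact integral_dirac g x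
  simp only [hdirac] at h
  have h0 := h.tendsto_div_nhds_zero
  have h1 : Tendsto (fun _ : ℝ => q x - p x) (𝓝[>] 0) (𝓝 0) := by
    refine h0.congr' ?_
    filter_upwards [self_mem_nhdsWithin] with t ht
    have ht0 : t ≠ 0 := ne_of_gt ht
    field_simp
    ring
  have h2 := tendsto_nhds_unique h1 tendsto_const_nhds
  linarith

theorem existsUnique_gradient (hφ : φ 1 = 0) (hε : 0 < ε)
    (hC : ∀ x y, C (x, y) = C (y, x)) (hpos : IsPositiveKernel (gibbsKernel C ε))
    (huniv : IsUniversalKernel (gibbsKernel C ε)) {α : FiniteMeasure X} (hα : α ≠ 0) :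
    ∃! p : C(X, ℝ), HasMeasureGradientAt
      (fun γ => (sinkhornEntropy φ C ε γ).toReal) α p := by
  obtain ⟨f, p, H, hle, -⟩ :=
    exists_isSinkhornPotential_forall_add_le (φ := φ) hφ hε hC hpos huniv hα
  have hp := H.hasMeasureGradientAt hφ hε hC hpos hle
  exact ⟨p, hp, fun q hq => hq.unique hp⟩

theorem measureGradient_eq {F : FiniteMeasure X → ℝ} {α : FiniteMeasure X} {p : C(X, ℝ)}
    (hp : HasMeasureGradientAt F α p) : measureGradient F α = p := by
  have h : ∃ p, HasMeasureGradientAt F α p := ⟨p, hp⟩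
  rw [measureGradient, dif_pos h]
  exact h.choose_spec.unique hp

theorem toReal_add_measureGradient_lt (hφ : φ 1 = 0) (hε : 0 < ε)
    (hC : ∀ x y, C (x, y) = C (y, x)) (hpos : IsPositiveKernel (gibbsKernel C ε))
    (huniv : IsUniversalKernel (gibbsKernel C ε)) {α β : FiniteMeasure X} (hα : α ≠ 0)
    (hβα : β ≠ α) :
    (sinkhornEntropy φ C ε α).toReal +
      (∫ x, measureGradient (fun γ => (sinkhornEntropy φ C ε γ).toReal) α x ∂(β : Measure X) -
        ∫ x, measureGradient (fun γ => (sinkhornEntropy φ C ε γ).toReal) α x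
          ∂(α : Measure X)) < (sinkhornEntropy φ C ε β).toReal := by
  obtain ⟨f, p, H, hle, hlt⟩ :=
    exists_isSinkhornPotential_forall_add_le (φ := φ) hφ hε hC hpos huniv hα
  rw [measureGradient_eq (H.hasMeasureGradientAt hφ hε hC hpos hle)]
  exact hlt β hβα

theorem hausdorffDivergence_self (α : FiniteMeasure X) : hausdorffDivergence φ C ε α α = 0 := by
  simp [hausdorffDivergence]

/-- Sum of the two strict subgradient inequalities, at `α` and at `β`. -/
theorem hausdorffDivergence_pos (hφ : φ 1 = 0) (hε : 0 < ε)
    (hC : ∀ x y, C (x, y) = C (y, x)) (hpos : IsPositiveKernel (gibbsKernel C ε))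
    (huniv : IsUniversalKernel (gibbsKernel C ε)) {α β : FiniteMeasure X} (hα : α ≠ 0)
    (hβ : β ≠ 0) (hαβ : α ≠ β) : 0 < hausdorffDivergence φ C ε α β := by
  have h1 := toReal_add_measureGradient_lt (φ := φ) hφ hε hC hpos huniv hα hαβ.symm
  have h2 := toReal_add_measureGradient_lt (φ := φ) hφ hε hC hpos huniv hβ hαβ
  unfold hausdorffDivergence
  have hint : ∀ (p : C(X, ℝ)) (γ : FiniteMeasure X), Integrable p (γ : Measure X) :=
    fun p γ => integrable_of_continuous (map_continuous p) _
  rw [integral_signed_sub (by fun_prop), integral_sub (hint _ _) (hint _ _),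
    integral_sub (hint _ _) (hint _ _)]
  linarith

end Gradient

/-! ### Equivalence of the measures and characterisation of optimal potentials -/

section Primal

variable {X : Type*} [MetricSpace X] [CompactSpace X] [MeasurableSpace X] [BorelSpace X]
  {C : C(X × X, ℝ)}

theorem gibbsMeasure_absolutelyContinuous (f : C(X, ℝ)) (α : FiniteMeasure X) :
    (gibbsMeasure ε f α : Measure X) ≪ (α : Measure X) :=
  withDensity_absolutelyContinuous _ _

theorem absolutelyContinuous_gibbsMeasure (f : C(X, ℝ)) (α : FiniteMeasure X) :
    (α : Measure X) ≪ (gibbsMeasure ε f α : Measure X) := by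
  have h := gibbsMeasure_absolutelyContinuous (ε := ε) (-f) (gibbsMeasure ε f α)
  rwa [gibbsMeasure_neg_gibbsMeasure] at h

theorem gibbsMeasure_congr_ae {f g : C(X, ℝ)} {α : FiniteMeasure X}
    (h : ∀ᵐ x ∂(α : Measure X), f x = g x) : gibbsMeasure ε f α = gibbsMeasure ε g α :=
  Subtype.ext (withDensity_congr_ae (h.mono fun x hx => by simp only [hx]))

namespace IsSinkhornPotential

variable {α : FiniteMeasure X} {f p : C(X, ℝ)}

/-- Dual optimality of `g` is primal optimality of `exp (g / ε) α`, and the primal minimiser is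
unique. -/
theorem isOptimalPotential_iff (H : IsSinkhornPotential φ C ε α f p) (hφ : φ 1 = 0)
    (hε : 0 < ε) (hC : ∀ x y, C (x, y) = C (y, x)) (hpos : IsPositiveKernel (gibbsKernel C ε))
    (huniv : IsUniversalKernel (gibbsKernel C ε)) (g : C(X, ℝ)) :
    IsOptimalPotential φ C ε α g ↔ gibbsMeasure ε g α = gibbsMeasure ε f α := by
  simp only [IsOptimalPotential, dualFunctional_eq_neg_primalFunctional hε, EReal.neg_le_neg_iff]
  constructor
  · intro h
    exact H.eq_gibbsMeasure hφ hε hC hpos huniv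
      (le_antisymm (H.primalFunctional_le hφ hε hC hpos _) (h f))
  · intro h g'
    rw [h]
    exact H.primalFunctional_le hφ hε hC hpos _

theorem gibbsMeasure_eq_iff (hε : 0 < ε) (g : C(X, ℝ)) :
    gibbsMeasure ε g α = gibbsMeasure ε f α ↔ ∀ᵐ x ∂(α : Measure X),
      ((g x : ℝ) : EReal) = logDensity ε α (gibbsMeasure ε f α) x := by
  constructor
  · intro h
    rw [← h]
    exact (logDensity_gibbsMeasure hε g α).mono fun x hx => hx.symm
  · intro h
    refine gibbsMeasure_congr_ae ?_
    filter_upwards [h, logDensity_gibbsMeasure hε f α] with x hx hx'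
    rw [hx'] at hx
    exact_mod_cast hx

end IsSinkhornPotential

end Primal

end UnbalancedOT

end

theorem mainTheorem7 {X : Type*} [MetricSpace X] [CompactSpace X] [MeasurableSpace X]
    [BorelSpace X] (φ : ℝ≥0 → ℝ≥0∞) (hφ : UnbalancedOT.IsEntropyFunction φ)
    (C : C(X × X, ℝ)) (hC : ∀ x y, C (x, y) = C (y, x)) (ε : ℝ) (hε : 0 < ε)
    (hpos : UnbalancedOT.IsPositiveKernel (UnbalancedOT.gibbsKernel C ε))
    (huniv : UnbalancedOT.IsUniversalKernel (UnbalancedOT.gibbsKernel C ε)) :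
    -- the Sinkhorn entropy is finite
    (∀ α : FiniteMeasure X, UnbalancedOT.sinkhornEntropy φ C ε α ≠ ⊥ ∧
      UnbalancedOT.sinkhornEntropy φ C ε α ≠ ⊤) ∧
    -- it is the infimum of the variational problem, attained at exactly one measure, which is
    -- equivalent to `α` and whose log-density is the optimal dual potential
    (∀ α : FiniteMeasure X,
      UnbalancedOT.sinkhornEntropy φ C ε α =
        ⨅ μ : FiniteMeasure X, UnbalancedOT.primalFunctional φ C ε α μ ∧
      ∃ μα : FiniteMeasure X,
        (∀ μ : FiniteMeasure X, UnbalancedOT.sinkhornEntropy φ C ε α =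
          UnbalancedOT.primalFunctional φ C ε α μ ↔ μ = μα) ∧
        (α : Measure X) ≪ (μα : Measure X) ∧ (μα : Measure X) ≪ (α : Measure X) ∧
        (∃ f : C(X, ℝ), UnbalancedOT.IsOptimalPotential φ C ε α f) ∧
        (∀ f : C(X, ℝ), UnbalancedOT.IsOptimalPotential φ C ε α f ↔
          ∀ᵐ x ∂(α : Measure X), ((f x : ℝ) : EReal) = UnbalancedOT.logDensity ε α μα x)) ∧
    -- strict convexity and weak* continuity
    StrictConvexOn ℝ≥0 Set.univ
      (fun α : FiniteMeasure X => (UnbalancedOT.sinkhornEntropy φ C ε α).toReal) ∧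
    Continuous (fun α : FiniteMeasure X => UnbalancedOT.sinkhornEntropy φ C ε α) ∧
    -- the gradients exist and are unique, and the Hausdorff divergence is positive definite
    (∀ α : FiniteMeasure X, α ≠ 0 → ∃! p : C(X, ℝ), UnbalancedOT.HasMeasureGradientAt
      (fun γ => (UnbalancedOT.sinkhornEntropy φ C ε γ).toReal) α p) ∧
    (∀ α β : FiniteMeasure X, α ≠ 0 → β ≠ 0 →
      0 ≤ UnbalancedOT.hausdorffDivergence φ C ε α β ∧
      (UnbalancedOT.hausdorffDivergence φ C ε α β = 0 ↔ α = β)) := by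
  have h1 := hφ.one
  refine ⟨UnbalancedOT.sinkhornEntropy_ne_bot_and_ne_top h1 hε hC hpos, fun α => ?_,
    UnbalancedOT.strictConvexOn_sinkhornEntropy h1 hε hC hpos huniv,
    UnbalancedOT.continuous_sinkhornEntropy h1 hε hC hpos huniv,
    fun α hα => UnbalancedOT.existsUnique_gradient h1 hε hC hpos huniv hα,
    fun α β hα hβ => ?_⟩
  · obtain ⟨f, p, H⟩ := UnbalancedOT.exists_isSinkhornPotential (C := C) h1 hε α
    have hF := H.sinkhornEntropy_eq h1 hε hC hpos
    refine ⟨?_, UnbalancedOT.gibbsMeasure ε f α, fun μ => ?_,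
      UnbalancedOT.absolutelyContinuous_gibbsMeasure f α,
      UnbalancedOT.gibbsMeasure_absolutelyContinuous f α,
      ⟨f, (H.isOptimalPotential_iff h1 hε hC hpos huniv f).2 rfl⟩, fun g => ?_⟩
    · rw [hF]
      exact le_antisymm (le_iInf fun μ => H.primalFunctional_le h1 hε hC hpos μ) (iInf_le _ _)
    · rw [hF]
      exact ⟨fun h => H.eq_gibbsMeasure h1 hε hC hpos huniv h, fun h => by rw [h]⟩
    · rw [H.isOptimalPotential_iff h1 hε hC hpos huniv,
        UnbalancedOT.IsSinkhornPotential.gibbsMeasure_eq_iff hε]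
  · by_cases hαβ : α = β
    · rw [hαβ, UnbalancedOT.hausdorffDivergence_self]
      simp
    · have h := UnbalancedOT.hausdorffDivergence_pos (φ := φ) h1 hε hC hpos huniv hα hβ hαβ
      exact ⟨h.le, fun h0 => absurd h0 h.ne', fun h0 => absurd h0 hαβ⟩
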